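/- Let $i_0, j_0$ be positive integers, $n_0$ a non-negative integer, and let $t_{i,j}$ ($1\le i\le i_0$, $0\le j\le j_0$) be real numbers such that $\hat t_i := \sum_{j=0}^{j_0} t_{i,j} \ge 0$ for every $i$. Let $\lambda_1>0$ be a root of multiplicity one of the polynomial $$T(x) = x^{i_0} - \sum_{i=1}^{i_0} \hat t_i\, x^{i_0-i},$$ and suppose that all other complex roots of $T$ have modulus strictly less than $\lambda_1$. Let $(p_{n,k})_{n,k\in\mathbb Z}$ be non-negative real numbers such that $p_{n,k}=0$ whenever $n<0$ or $k<0$, only finitely many $p_{n,k}$ with $n<n_0$ are nonzero, $$p_{n,k} = \sum_{i=1}^{i_0}\sum_{j=0}^{j_0} t_{i,j}\,p_{n-i,k-j}\qquad\text{for all } n\ge n_0,\ k\in\mathbb Z,$$ and $\sum_{k=0}^\infty p_{n,k} = \Theta(\lambda_1^n)$ as $n\to\infty$. Put $$C_\mu = \frac{\sum_{i=1}^{i_0}\sum_{j=0}^{j_0} t_{i,j}\, j\,\lambda_1^{-i}}{\sum_{i=1}^{i_0}\sum_{j=0}^{j_0} t_{i,j}\, i\,\lambda_1^{-i}},\qquad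 C_\sigma = \frac{\sum_{i=1}^{i_0}\sum_{j=0}^{j_0} t_{i,j}\,\lambda_1^{-i}\,(j-C_\mu i)^2}{\sum_{i=1}^{i_0}\sum_{j=0}^{j_0} t_{i,j}\, i\,\lambda_1^{-i}},$$ and assume $C_\sigma>0$. For every $n$ with $\sum_{i\ge 0}p_{n,i}\ne 0$ (hence for all large $n$) let $X_n$ be a random variable with values in $\{0,1,2,\dots\}$ and $$\Pr[X_n=k] = \frac{p_{n,k}}{\sum_{i=0}^\infty p_{n,i}}\qquad (k\ge 0),$$ and let $\mu_n$ and $\sigma_n^2$ be its mean and variance. Then there exist constants $d_\mu,d_\sigma\in\mathbb R$ and $\gamma_\mu,\gamma_\sigma\in(0,1)$ such that, as $n\to\infty$, $$\mu_n = C_\mu n + d_\mu + O(\gamma_\mu^n),\qquad \sigma_n^2 = C_\sigma n + d_\sigma + O(\gamma_\sigma^n),$$ and $(X_n-\mu_n)/\sigma_n$ converges weakly to the standard normal distribution $N(0,1)$ as $n\to\infty$. -/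

import Mathlib

open MeasureTheory ProbabilityTheory Filter Asymptotics Polynomial

noncomputable section

namespace TwoDimRec

/-- A real polynomial `A` has the maximum root property with maximum root `r > 0`: `r` is a root of
multiplicity one, and every other complex root has modulus strictly less than `r`. -/
def HasMaxRoot (A : ℝ[X]) (r : ℝ) : Prop :=
  0 < r ∧ A.rootMultiplicity r = 1 ∧
    ∀ z : ℂ, aeval z A = 0 → z ≠ (r : ℂ) → ‖z‖ < r

/-- The collapsed coefficient `t̂ᵢ = ∑_{j=0}^{j₀} t_{i,j}`. -/
def tHat (j₀ : ℕ) (t : ℕ → ℕ → ℝ) (i : ℕ) : ℝ :=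
  ∑ j ∈ Finset.Icc 0 j₀, t i j

/-- The collapsed characteristic polynomial `T(x) = x^{i₀} - ∑_{i=1}^{i₀} t̂ᵢ x^{i₀-i}`. -/
def charPoly (i₀ j₀ : ℕ) (t : ℕ → ℕ → ℝ) : ℝ[X] :=
  X ^ i₀ - ∑ i ∈ Finset.Icc 1 i₀, C (tHat j₀ t i) * X ^ (i₀ - i)

/-- The total mass `∑_{k=0}^∞ p_{n,k}` of the `n`-th row. -/
def rowSum (p : ℤ → ℤ → ℝ) (n : ℕ) : ℝ :=
  ∑' k : ℕ, p n k

/-- The constant `C_μ` attached to the coefficients `t` and the root `r`. -/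
def Cmu (i₀ j₀ : ℕ) (t : ℕ → ℕ → ℝ) (r : ℝ) : ℝ :=
  (∑ i ∈ Finset.Icc 1 i₀, ∑ j ∈ Finset.Icc 0 j₀, t i j * (j : ℝ) / r ^ i) /
    (∑ i ∈ Finset.Icc 1 i₀, ∑ j ∈ Finset.Icc 0 j₀, t i j * (i : ℝ) / r ^ i)

/-- The constant `C_σ` attached to the coefficients `t` and the root `r`. -/
def Csigma (i₀ j₀ : ℕ) (t : ℕ → ℕ → ℝ) (r : ℝ) : ℝ :=
  (∑ i ∈ Finset.Icc 1 i₀, ∑ j ∈ Finset.Icc 0 j₀,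
      t i j / r ^ i * ((j : ℝ) - Cmu i₀ j₀ t r * (i : ℝ)) ^ 2) /
    (∑ i ∈ Finset.Icc 1 i₀, ∑ j ∈ Finset.Icc 0 j₀, t i j * (i : ℝ) / r ^ i)

end TwoDimRec

end

/-!
The generating function of row `n` obeys a one-dimensional recurrence whose coefficients depend
analytically on the parameter `s`. At `s = 0` its characteristic polynomial is `T`, so by the
implicit function theorem it keeps a root `λ₁ * exp (L s)` for small complex `s`, with `L` analytic,
`L 0 = 0`, `L' 0 = C_μ` and `L'' 0 = C_σ`. After division by `exp (n * L s)` the root is `λ₁`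
itself, and dividing it out of the polynomial leaves only roots of modulus less than `λ₁`. A bound
on powers that is uniform in `s` then yields `exp (n * L s) * (g s + O (γ ^ n))` for the moment
generating function of `X n`. Two derivatives at `s = 0` give the mean and the variance, and the
values at `s = i * x / σ n` give the characteristic function in the limit.
-/

namespace TwoDimRec

open scoped Topology NNReal ENNReal

section PowerBounds

theorem norm_pow_le_mul_pow_of_norm_pow_le {A : Type*} [SeminormedRing A] {a : A} {K γ : ℝ} {N : ℕ}
    (hN : N ≠ 0) (hpow : ‖a ^ N‖ ≤ γ ^ N) (hlt : ∀ k < N, ‖a ^ k‖ ≤ K * γ ^ k) (n : ℕ) :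
    ‖a ^ n‖ ≤ K * γ ^ n := by
  induction n using Nat.strong_induction_on with
  | _ n ih =>
    rcases lt_or_ge n N with h | h
    · exact hlt n h
    · have hprev := ih (n - N) (by omega)
      calc ‖a ^ n‖ = ‖a ^ (n - N) * a ^ N‖ := by rw [← pow_add, Nat.sub_add_cancel h]
        _ ≤ ‖a ^ (n - N)‖ * ‖a ^ N‖ := norm_mul_le _ _
        _ ≤ K * γ ^ (n - N) * γ ^ N :=
          mul_le_mul hprev hpow (norm_nonneg _) ((norm_nonneg _).trans hprev)
        _ = K * γ ^ n := by rw [mul_assoc, ← pow_add, Nat.sub_add_cancel h]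

variable {A : Type*} [NormedRing A] [NormedAlgebra ℂ A] [CompleteSpace A]

theorem exists_norm_pow_lt_of_spectralRadius_lt {a : A} {γ : ℝ≥0} (h : spectralRadius ℂ a < γ) :
    ∃ N : ℕ, N ≠ 0 ∧ ‖a ^ N‖ < γ ^ N := by
  have gelfand := (spectrum.pow_nnnorm_pow_one_div_tendsto_nhds_spectralRadius a).eventually
    (gt_mem_nhds h)
  obtain ⟨N, hlt, hN⟩ := (gelfand.and (eventually_ne_atTop 0)).exists
  refine ⟨N, hN, ?_⟩
  have hN' : (0 : ℝ) < N := by positivity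
  rw [one_div, ENNReal.rpow_inv_lt_iff hN', ENNReal.rpow_natCast] at hlt
  exact_mod_cast hlt

theorem exists_eventually_norm_pow_le {Y : Type*} [TopologicalSpace Y] {a : Y → A} {y : Y}
    {ρ : ℝ≥0} (ha : ContinuousAt a y) (h : spectralRadius ℂ (a y) < ρ) :
    ∃ K γ : ℝ, 0 < γ ∧ γ < ρ ∧ ∀ᶠ x in 𝓝 y, ∀ n : ℕ, ‖a x ^ n‖ ≤ K * γ ^ n := by
  obtain ⟨γ, hγ, hγρ⟩ := ENNReal.lt_iff_exists_nnreal_btwn.1 h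
  obtain ⟨N, hN, hlt⟩ := exists_norm_pow_lt_of_spectralRadius_lt hγ
  have hγ0 : 0 < γ := by
    refine pos_iff_ne_zero.2 fun h0 => ?_
    simp [h0] at hγ
  have hscaled : ContinuousAt (fun x (k : Fin N) => ((γ : ℂ) ^ (k : ℕ))⁻¹ • a x ^ (k : ℕ)) y :=
    continuousAt_pi.2 fun k => (ha.pow _).const_smul _
  obtain ⟨K, hK⟩ := hscaled.norm.isBoundedUnder_le
  have hN' := (ha.pow N).norm.eventually_lt_const hlt
  refine ⟨K, γ, hγ0, mod_cast hγρ, ((eventually_map.1 hK).and hN').mono fun x hx => ?_⟩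
  refine norm_pow_le_mul_pow_of_norm_pow_le hN hx.2.le fun k hk => ?_
  have hk' := (norm_le_pi_norm _ (⟨k, hk⟩ : Fin N)).trans hx.1
  rw [norm_smul, norm_inv, norm_pow, inv_mul_le_iff₀ (pow_pos (by simpa using hγ0) _)] at hk'
  simpa [mul_comm] using hk'

end PowerBounds

section LinearRecurrence

variable {R : Type*} [CommRing R] (E : LinearRecurrence R)

theorem tupleSucc_pow_apply_of_isSolution {u : ℕ → R} (hu : E.IsSolution u) (n : ℕ) :
    (E.tupleSucc ^ n) (fun i : Fin E.order => u i) = fun i : Fin E.order => u (n + i) := by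
  induction n with
  | zero => simp
  | succ n ih =>
    rw [pow_succ', Module.End.mul_apply, ih]
    funext i
    simp only [LinearRecurrence.tupleSucc, LinearMap.coe_mk, AddHom.coe_mk]
    split_ifs with h
    · congr 1
      omega
    · rw [← hu n]
      congr 1
      omega

theorem aeval_tupleSucc_charPoly : aeval E.tupleSucc E.charPoly = 0 := by
  refine LinearMap.ext fun init => funext fun i => ?_
  have hpow (n : ℕ) : (E.tupleSucc ^ n) init = fun i : Fin E.order => E.mkSol init (n + i) := by
    rw [← tupleSucc_pow_apply_of_isSolution E (E.is_sol_mkSol init)]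
    simp only [E.mkSol_eq_init]
  have hsol := E.is_sol_mkSol init i
  simp [LinearRecurrence.charPoly, aeval_monomial, hpow, LinearMap.sum_apply, add_comm _ (i : ℕ),
    hsol, Module.algebraMap_end_apply]

theorem isRoot_charPoly_of_mem_spectrum_tupleSucc {K : Type*} [Field K] {E : LinearRecurrence K}
    {z : K} (hz : z ∈ spectrum K E.tupleSucc) : E.charPoly.IsRoot z := by
  rcases subsingleton_or_nontrivial (Module.End K (Fin E.order → K)) with h | h
  · simp [spectrum.of_subsingleton] at hz
  · have hmem := spectrum.subset_polynomial_aeval E.tupleSucc E.charPoly ⟨z, hz, rfl⟩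
    rwa [aeval_tupleSucc_charPoly, spectrum.zero_eq, Set.mem_singleton_iff] at hmem

section Decay

variable {Y : Type*} [TopologicalSpace Y] {m : ℕ} {c : Y → Fin m → ℂ} {y : Y}

theorem continuousAt_toContinuousLinearMap_tupleSucc (hc : ContinuousAt c y) :
    ContinuousAt (fun x =>
      Module.End.toContinuousLinearMap (Fin m → ℂ) (LinearRecurrence.mk m (c x)).tupleSucc) y := by
  refine continuousAt_clm_apply.2 fun v => continuousAt_pi.2 fun i => ?_
  have hsum : ContinuousAt (fun x => ∑ j, c x j * v j) y :=
    tendsto_finsetSum _ fun j _ => (continuousAt_pi.1 hc j).mul_const _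
  by_cases h : (i : ℕ) + 1 < m
  · simpa [Module.End.toContinuousLinearMap, LinearRecurrence.tupleSucc, h] using continuousAt_const
  · simpa [Module.End.toContinuousLinearMap, LinearRecurrence.tupleSucc, h] using hsum

theorem spectralRadius_toContinuousLinearMap_tupleSucc_lt {E : LinearRecurrence ℂ} {ρ : ℝ≥0}
    (hρ : 0 < ρ) (hroot : ∀ z, E.charPoly.IsRoot z → ‖z‖ < ρ) :
    spectralRadius ℂ (Module.End.toContinuousLinearMap (Fin E.order → ℂ) E.tupleSucc) < ρ := by
  rcases subsingleton_or_nontrivial ((Fin E.order → ℂ) →L[ℂ] (Fin E.order → ℂ)) with h | h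
  · simpa [spectrum.SpectralRadius.of_subsingleton] using hρ
  · refine spectrum.spectralRadius_lt_of_forall_lt _ fun z hz => ?_
    rw [AlgEquiv.spectrum_eq] at hz
    exact hroot z (isRoot_charPoly_of_mem_spectrum_tupleSucc hz)

theorem exists_eventually_norm_isSolution_le {ρ : ℝ≥0} (hρ : 0 < ρ) (hc : ContinuousAt c y)
    (hroot : ∀ z, (LinearRecurrence.mk m (c y)).charPoly.IsRoot z → ‖z‖ < ρ) {u : Y → ℕ → ℂ}
    (hu : ∀ᶠ x in 𝓝 y, (LinearRecurrence.mk m (c x)).IsSolution (u x))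
    (hinit : ∀ i < m, ContinuousAt (fun x => u x i) y) :
    ∃ K γ : ℝ, 0 < γ ∧ γ < ρ ∧ ∀ᶠ x in 𝓝 y, ∀ n, ‖u x n‖ ≤ K * γ ^ n := by
  obtain ⟨K, γ, hγ0, hγρ, hT⟩ :=
    exists_eventually_norm_pow_le (continuousAt_toContinuousLinearMap_tupleSucc hc)
      (spectralRadius_toContinuousLinearMap_tupleSucc_lt hρ hroot)
  have hinit' : ContinuousAt (fun x (i : Fin m) => u x i) y :=
    continuousAt_pi.2 fun i => hinit i i.2
  obtain ⟨C, hC⟩ := hinit'.norm.isBoundedUnder_le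
  refine ⟨K * C, γ, hγ0, hγρ, ?_⟩
  filter_upwards [hu, hT, eventually_map.1 hC] with x hsol hpow hsmall n
  have hwindow : ‖fun i : Fin m => u x (n + i)‖ ≤ K * γ ^ n * C := by
    rw [← tupleSucc_pow_apply_of_isSolution _ hsol]
    refine (ContinuousLinearMap.le_of_opNorm_le_of_le _ (hpow n) hsmall).trans' (le_of_eq ?_)
    rw [← map_pow]
    rfl
  rw [mul_right_comm]
  rcases m.eq_zero_or_pos with rfl | hm
  · have h0 : u x n = 0 := by simpa using hsol n
    rw [h0, norm_zero]
    exact (norm_nonneg _).trans hwindow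
  · exact (norm_le_pi_norm (fun i : Fin m => u x (n + i)) ⟨0, hm⟩).trans hwindow

end Decay

end LinearRecurrence

section Shift

variable {R : Type*} [CommRing R]

/-- The shift operator `(S u) n = u (n + 1)` on sequences. A sequence solves the linear recurrence
with characteristic polynomial `Q` exactly when `aeval S Q` kills it, so that factorisations of `Q`
become factorisations of the recurrence. -/
def shift (R : Type*) [CommRing R] : Module.End R (ℕ → R) :=
  LinearMap.funLeft R R Nat.succ

theorem shift_pow_apply (k : ℕ) (u : ℕ → R) (n : ℕ) : (shift R ^ k) u n = u (n + k) := by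
  induction k generalizing n with
  | zero => rfl
  | succ k ih =>
    rw [pow_succ', Module.End.mul_apply]
    exact (ih (n + 1)).trans (congrArg u (by omega))

theorem aeval_shift_apply (Q : R[X]) (u : ℕ → R) (n : ℕ) :
    aeval (shift R) Q u n = ∑ i ∈ Finset.range (Q.natDegree + 1), Q.coeff i * u (n + i) := by
  simp only [aeval_eq_sum_range, LinearMap.sum_apply, Finset.sum_apply, LinearMap.smul_apply,
    Pi.smul_apply, smul_eq_mul, shift_pow_apply]

theorem aeval_shift_X_sub_C_apply (r : R) (u : ℕ → R) (n : ℕ) :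
    aeval (shift R) (X - C r) u n = u (n + 1) - r * u n := by
  simp [shift, LinearMap.funLeft_apply, Module.algebraMap_end_apply]

theorem charPoly_mk_neg_coeff {Q : R[X]} (hQ : Q.Monic) :
    (LinearRecurrence.mk Q.natDegree fun i => -Q.coeff i).charPoly = Q := by
  conv_rhs => rw [hQ.as_sum]
  simp [LinearRecurrence.charPoly, Finset.sum_range, ← C_mul_X_pow_eq_monomial]

theorem isSolution_of_aeval_shift_eq_zero {Q : R[X]} (hQ : Q.Monic) {u : ℕ → R}
    (hu : aeval (shift R) Q u = 0) :
    (LinearRecurrence.mk Q.natDegree fun i => -Q.coeff i).IsSolution u := by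
  intro n
  have hn := congrFun hu n
  rw [aeval_shift_apply, Finset.sum_range_succ, hQ.coeff_natDegree, one_mul, Finset.sum_range] at hn
  simpa [add_comm] using eq_neg_of_add_eq_zero_right hn

theorem exists_eventually_norm_le_of_aeval_shift_eq_zero {Y : Type*} [TopologicalSpace Y] {y : Y}
    {ρ : ℝ≥0} (hρ : 0 < ρ) {m : ℕ} {Q : Y → ℂ[X]} (hmonic : ∀ x, (Q x).Monic)
    (hdeg : ∀ x, (Q x).natDegree = m) (hcoeff : ∀ i, ContinuousAt (fun x => (Q x).coeff i) y)
    (hroot : ∀ z, (Q y).IsRoot z → ‖z‖ < ρ) {u : Y → ℕ → ℂ}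
    (hu : ∀ᶠ x in 𝓝 y, aeval (shift ℂ) (Q x) (u x) = 0)
    (hinit : ∀ i < m, ContinuousAt (fun x => u x i) y) :
    ∃ K γ : ℝ, 0 < γ ∧ γ < ρ ∧ ∀ᶠ x in 𝓝 y, ∀ n, ‖u x n‖ ≤ K * γ ^ n := by
  refine exists_eventually_norm_isSolution_le (c := fun x (i : Fin m) => -(Q x).coeff i) hρ
    (continuousAt_pi.2 fun i => (hcoeff i).neg) (fun z hz => hroot z ?_) (hu.mono fun x hx => ?_)
    hinit
  · have h := charPoly_mk_neg_coeff (hmonic y)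
    rw [hdeg y] at h
    rwa [← h]
  · have h := isSolution_of_aeval_shift_eq_zero (hmonic x) hx
    rwa [hdeg x] at h

theorem exists_eventually_norm_succ_sub_mul_le {Y : Type*} [TopologicalSpace Y] {y : Y}
    {ρ : ℝ≥0} (hρ : 0 < ρ) {d : ℕ} {Q : Y → ℂ[X]} (hmonic : ∀ x, (Q x).Monic)
    (hdeg : ∀ x, (Q x).natDegree = d) (hcoeff : ∀ i, ContinuousAt (fun x => (Q x).coeff i) y)
    {r : ℂ} (hr : ∀ᶠ x in 𝓝 y, (Q x).IsRoot r)
    (hroot : ∀ z, (Q y /ₘ (X - C r)).IsRoot z → ‖z‖ < ρ) {u : Y → ℕ → ℂ}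
    (hu : ∀ᶠ x in 𝓝 y, aeval (shift ℂ) (Q x) (u x) = 0)
    (hinit : ∀ i ≤ d, ContinuousAt (fun x => u x i) y) :
    ∃ K γ : ℝ, 0 < γ ∧ γ < ρ ∧ ∀ᶠ x in 𝓝 y, ∀ n, ‖u x (n + 1) - r * u x n‖ ≤ K * γ ^ n := by
  have hd : 0 < d :=
    hdeg y ▸ natDegree_pos_iff_degree_pos.2 (degree_pos_of_root (hmonic y).ne_zero hr.self_of_nhds)
  have hdegree (x : Y) : (X - C r).degree ≤ (Q x).degree := by
    rw [degree_X_sub_C, degree_eq_natDegree (hmonic x).ne_zero, hdeg x]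
    exact_mod_cast hd
  simp_rw [← aeval_shift_X_sub_C_apply]
  refine exists_eventually_norm_le_of_aeval_shift_eq_zero hρ (m := d - 1)
    (Q := fun x => Q x /ₘ (X - C r)) (fun x => ?_) (fun x => ?_) (fun i => ?_) hroot ?_
    fun i hi => ?_
  · exact (leadingCoeff_divByMonic_of_monic (monic_X_sub_C r) (hdegree x)).trans (hmonic x)
  · rw [natDegree_divByMonic _ (monic_X_sub_C r), hdeg x, natDegree_X_sub_C]
  · simp only [coeff_divByMonic_X_sub_C, hdeg]
    exact tendsto_finsetSum _ fun j _ => (hcoeff j).const_mul _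
  · filter_upwards [hr, hu] with x hrx hux
    rw [← Module.End.mul_apply, ← map_mul, mul_comm, mul_divByMonic_eq_iff_isRoot.2 hrx, hux]
  · simp only [aeval_shift_X_sub_C_apply]
    exact (hinit _ (by omega)).sub ((hinit _ (by omega)).const_mul r)

end Shift

section RecPoly

variable {R : Type*} [CommRing R]

/-- The characteristic polynomial `x ^ d - ∑ b i * x ^ (d - i)` of the recurrence
`u n = ∑ b i * u (n - i)`, where `1 ≤ i ≤ d`; `charPoly i₀ j₀ t` is the case `b = tHat j₀ t`. -/
noncomputable def recPoly (d : ℕ) (b : ℕ → R) : R[X] :=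
  X ^ d - ∑ i ∈ Finset.Icc 1 d, C (b i) * X ^ (d - i)

theorem degree_sum_C_mul_X_pow_sub_lt [Nontrivial R] (d : ℕ) (b : ℕ → R) :
    (∑ i ∈ Finset.Icc 1 d, C (b i) * X ^ (d - i)).degree < (d : WithBot ℕ) := by
  refine (degree_sum_le _ _).trans_lt ((Finset.sup_lt_iff (WithBot.bot_lt_coe d)).2 fun i hi => ?_)
  have hi' := Finset.mem_Icc.1 hi
  exact (degree_C_mul_X_pow_le _ _).trans_lt (WithBot.coe_lt_coe.2 (Nat.sub_lt_self hi'.1 hi'.2))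

theorem monic_recPoly [Nontrivial R] (d : ℕ) (b : ℕ → R) : (recPoly d b).Monic :=
  monic_X_pow_sub (degree_sum_C_mul_X_pow_sub_lt d b)

theorem natDegree_recPoly [Nontrivial R] (d : ℕ) (b : ℕ → R) : (recPoly d b).natDegree = d := by
  have h := degree_sub_eq_left_of_degree_lt (p := X ^ d)
    ((degree_sum_C_mul_X_pow_sub_lt d b).trans_eq (degree_X_pow d).symm)
  exact natDegree_eq_of_degree_eq_some (h.trans (degree_X_pow d))

theorem map_recPoly {S : Type*} [CommRing S] (f : R →+* S) (d : ℕ) (b : ℕ → R) :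
    (recPoly d b).map f = recPoly d fun i => f (b i) := by
  simp [recPoly, Polynomial.map_sum]

theorem continuousAt_coeff_recPoly {Y : Type*} [TopologicalSpace Y] {b : Y → ℕ → ℂ} {y : Y}
    (hb : ∀ i, ContinuousAt (fun x => b x i) y) (d k : ℕ) :
    ContinuousAt (fun x => (recPoly d (b x)).coeff k) y := by
  simp only [recPoly, coeff_sub, finsetSum_coeff, coeff_C_mul]
  exact continuousAt_const.sub (tendsto_finsetSum _ fun i _ => (hb i).mul_const _)

theorem aeval_shift_recPoly_eq_zero {d : ℕ} {b u : ℕ → R}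
    (hu : ∀ n ≥ d, u n = ∑ i ∈ Finset.Icc 1 d, b i * u (n - i)) :
    aeval (shift R) (recPoly d b) u = 0 := by
  funext n
  have hsum : ∑ i ∈ Finset.Icc 1 d, b i * u (n + (d - i)) =
      ∑ i ∈ Finset.Icc 1 d, b i * u (n + d - i) :=
    Finset.sum_congr rfl fun i hi => by rw [Nat.add_sub_assoc (Finset.mem_Icc.1 hi).2]
  simp [recPoly, LinearMap.sum_apply, Finset.sum_apply, shift_pow_apply, hsum,
    hu (n + d) (by omega), Module.algebraMap_end_apply]

theorem eval_recPoly {K : Type*} [Field K] (d : ℕ) (b : ℕ → K) {r : K} (hr : r ≠ 0) :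
    (recPoly d b).eval r = r ^ d * (1 - ∑ i ∈ Finset.Icc 1 d, b i / r ^ i) := by
  rw [recPoly, eval_sub, eval_finsetSum, mul_sub, mul_one, Finset.mul_sum, eval_pow, eval_X]
  congr 1
  refine Finset.sum_congr rfl fun i hi => ?_
  rw [eval_mul, eval_C, eval_pow, eval_X, pow_sub₀ r hr (Finset.mem_Icc.1 hi).2]
  ring

theorem isRoot_recPoly_iff {K : Type*} [Field K] {d : ℕ} {b : ℕ → K} {r : K} (hr : r ≠ 0) :
    (recPoly d b).IsRoot r ↔ ∑ i ∈ Finset.Icc 1 d, b i / r ^ i = 1 := by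
  rw [IsRoot, eval_recPoly d b hr, mul_eq_zero_iff_left (pow_ne_zero d hr), sub_eq_zero, eq_comm]

theorem X_mul_derivative_recPoly (d : ℕ) (b : ℕ → R) :
    X * derivative (recPoly d b) =
      (d : R[X]) * recPoly d b + ∑ i ∈ Finset.Icc 1 d, C (i * b i) * X ^ (d - i) := by
  have hXpow (k : ℕ) : X * derivative (X ^ k : R[X]) = (k : R[X]) * X ^ k := by
    rcases k with _ | k
    · simp
    · rw [derivative_X_pow, Nat.add_sub_cancel, map_natCast, pow_succ]
      ring
  rw [recPoly, derivative_sub, mul_sub, hXpow, derivative_sum, mul_sub, Finset.mul_sum,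
    Finset.mul_sum, sub_add, ← Finset.sum_sub_distrib]
  congr 1
  refine Finset.sum_congr rfl fun i hi => ?_
  rw [derivative_C_mul, mul_left_comm, hXpow, Nat.cast_sub (Finset.mem_Icc.1 hi).2, C_mul,
    map_natCast]
  ring

theorem mul_eval_derivative_recPoly {K : Type*} [Field K] {d : ℕ} {b : ℕ → K} {r : K}
    (hr : r ≠ 0) (hroot : (recPoly d b).IsRoot r) :
    r * (derivative (recPoly d b)).eval r = r ^ d * ∑ i ∈ Finset.Icc 1 d, b i * i / r ^ i := by
  have h := congrArg (eval r) (X_mul_derivative_recPoly d b)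
  rw [eval_mul, eval_X, eval_add, eval_mul, hroot.eq_zero, mul_zero, zero_add,
    eval_finsetSum] at h
  rw [h, Finset.mul_sum]
  refine Finset.sum_congr rfl fun i hi => ?_
  rw [eval_mul, eval_C, eval_pow, eval_X, pow_sub₀ r hr (Finset.mem_Icc.1 hi).2]
  ring

end RecPoly

section MaxRoot

variable {A : ℝ[X]} {r : ℝ}

theorem HasMaxRoot.eval_divByMonic_ne_zero (h : HasMaxRoot A r) :
    (A /ₘ (X - C r)).eval r ≠ 0 := by
  have hA : A ≠ 0 := by
    rintro rfl
    simpa using h.2.1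
  simpa [h.2.1] using eval_divByMonic_pow_rootMultiplicity_ne_zero r hA

theorem HasMaxRoot.isRoot (h : HasMaxRoot A r) : A.IsRoot r :=
  (rootMultiplicity_pos'.1 (h.2.1 ▸ one_pos)).2

theorem HasMaxRoot.eval_derivative_ne_zero (h : HasMaxRoot A r) : (derivative A).eval r ≠ 0 := by
  rw [← divByMonic_add_X_sub_C_mul_derivative_divByMonic_eq_derivative A r]
  simpa using h.eval_divByMonic_ne_zero

theorem HasMaxRoot.norm_lt_of_isRoot_divByMonic (h : HasMaxRoot A r) {z : ℂ}
    (hz : (A.map Complex.ofRealHom /ₘ (X - C (r : ℂ))).IsRoot z) : ‖z‖ < r := by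
  have hfactor : A.map Complex.ofRealHom /ₘ (X - C (r : ℂ)) =
      (A /ₘ (X - C r)).map Complex.ofRealHom := by
    simp [map_divByMonic _ (monic_X_sub_C r)]
  refine h.2.2 z ?_ ?_
  · have hroot : (A.map Complex.ofRealHom).IsRoot (r : ℂ) := h.isRoot.map
    have hA := congrArg (eval z) (mul_divByMonic_eq_iff_isRoot.2 hroot)
    rw [eval_mul, hz.eq_zero, mul_zero] at hA
    rw [← eval_map_algebraMap]
    exact hA.symm
  · rintro rfl
    rw [hfactor, IsRoot, ← Complex.ofRealHom_eq_coe, eval_map_apply] at hz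
    exact h.eval_divByMonic_ne_zero (by simpa using hz)

end MaxRoot

section Exponent

open scoped ContDiff

theorem exists_analyticAt_implicit {f : ℂ × ℂ → ℂ} {a b : ℂ} (hf : AnalyticAt ℂ f (a, b))
    (hd : deriv (fun y => f (a, y)) b ≠ 0) :
    ∃ φ : ℂ → ℂ, AnalyticAt ℂ φ a ∧ φ a = b ∧ ∀ᶠ s in 𝓝 a, f (s, φ s) = f (a, b) := by
  have hsmooth : ContDiffAt ℂ ω f (a, b) := hf.contDiffAt
  have hinr : fderiv ℂ f (a, b) ∘L .inr ℂ ℂ ℂ =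
      (ContinuousLinearEquiv.unitsEquivAut ℂ (Units.mk0 _ hd) : ℂ →L[ℂ] ℂ) := by
    ext
    have hpartial := (hf.differentiableAt.hasFDerivAt.comp b
      (hasFDerivAt_prodMk_right a b)).hasDerivAt
    simpa [Function.comp_def] using hpartial.deriv.symm
  have hinv : (fderiv ℂ f (a, b) ∘L .inr ℂ ℂ ℂ).IsInvertible := ⟨_, hinr.symm⟩
  exact ⟨hsmooth.implicitFunction (by simp) hinv,
    (hsmooth.contDiffAt_implicitFunction (by simp) hinv).analyticAt,
    hsmooth.implicitFunction_apply_self (by simp) hinv,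
    hsmooth.eventually_apply_implicitFunction (by simp) hinv⟩

variable {ι : Type*} {S : Finset ι} {w α β : ι → ℂ}

theorem exists_analyticAt_sum_mul_exp_eq_one (hw : ∑ i ∈ S, w i = 1)
    (hα : ∑ i ∈ S, w i * α i ≠ 0) :
    ∃ L : ℂ → ℂ, AnalyticAt ℂ L 0 ∧ L 0 = 0 ∧
      ∀ᶠ s in 𝓝 0, ∑ i ∈ S, w i * Complex.exp (β i * s - α i * L s) = 1 := by
  let f (q : ℂ × ℂ) : ℂ := ∑ i ∈ S, w i * Complex.exp (β i * q.1 - α i * q.2)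
  have hf : ContDiffAt ℂ ω f (0, 0) := by fun_prop
  have hd : HasDerivAt (fun y => f (0, y)) (∑ i ∈ S, w i * -α i) 0 := by
    refine HasDerivAt.fun_sum fun i _ => ?_
    simpa using (((hasDerivAt_id (0 : ℂ)).const_mul (α i)).const_sub (β i * 0)).cexp.const_mul (w i)
  have hd0 : deriv (fun y => f (0, y)) 0 ≠ 0 := by simpa [hd.deriv] using hα
  simpa [f, hw] using exists_analyticAt_implicit hf.analyticAt hd0

variable {L : ℂ → ℂ}

theorem eventually_sum_mul_exp_mul_deriv_eq_zero (hL : AnalyticAt ℂ L 0)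
    (h : ∀ᶠ s in 𝓝 0, ∑ i ∈ S, w i * Complex.exp (β i * s - α i * L s) = 1) :
    ∀ᶠ s in 𝓝 0,
      ∑ i ∈ S, w i * (Complex.exp (β i * s - α i * L s) * (β i - α i * deriv L s)) = 0 := by
  filter_upwards [h.eventually_nhds, hL.eventually_analyticAt] with s hs hLs
  have hderiv : HasDerivAt (fun s => ∑ i ∈ S, w i * Complex.exp (β i * s - α i * L s))
      (∑ i ∈ S, w i * (Complex.exp (β i * s - α i * L s) * (β i - α i * deriv L s))) s := by
    refine HasDerivAt.fun_sum fun i _ => ?_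
    simpa using (((hasDerivAt_id s).const_mul (β i)).sub
      (hLs.differentiableAt.hasDerivAt.const_mul (α i))).cexp.const_mul (w i)
  exact hderiv.unique ((hasDerivAt_const s (1 : ℂ)).congr_of_eventuallyEq hs)

theorem sum_mul_mul_deriv_exponent (hL : AnalyticAt ℂ L 0) (hL0 : L 0 = 0)
    (h : ∀ᶠ s in 𝓝 0, ∑ i ∈ S, w i * Complex.exp (β i * s - α i * L s) = 1) :
    (∑ i ∈ S, w i * α i) * deriv L 0 = ∑ i ∈ S, w i * β i := by
  have hfirst := (eventually_sum_mul_exp_mul_deriv_eq_zero hL h).self_of_nhds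
  simp only [hL0, mul_zero, sub_zero, Complex.exp_zero, one_mul, mul_sub,
    Finset.sum_sub_distrib] at hfirst
  rw [Finset.sum_mul, sub_eq_zero.1 hfirst]
  exact Finset.sum_congr rfl fun i _ => mul_assoc _ _ _

theorem sum_mul_mul_deriv_deriv_exponent (hL : AnalyticAt ℂ L 0) (hL0 : L 0 = 0)
    (h : ∀ᶠ s in 𝓝 0, ∑ i ∈ S, w i * Complex.exp (β i * s - α i * L s) = 1) :
    (∑ i ∈ S, w i * α i) * deriv (deriv L) 0 = ∑ i ∈ S, w i * (β i - deriv L 0 * α i) ^ 2 := by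
  have hderiv : HasDerivAt
      (fun s => ∑ i ∈ S, w i * (Complex.exp (β i * s - α i * L s) * (β i - α i * deriv L s)))
      (∑ i ∈ S, w i * ((β i - deriv L 0 * α i) ^ 2 - α i * deriv (deriv L) 0)) 0 := by
    refine HasDerivAt.fun_sum fun i _ => ?_
    have hexp := (((hasDerivAt_id (0 : ℂ)).const_mul (β i)).sub
      (hL.differentiableAt.hasDerivAt.const_mul (α i))).cexp
    have hfactor := (hL.deriv.differentiableAt.hasDerivAt.const_mul (α i)).const_sub (β i)
    refine ((hexp.mul hfactor).const_mul (w i)).congr_deriv ?_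
    simp only [Pi.sub_apply, id_eq, hL0, mul_zero, sub_zero, Complex.exp_zero, mul_one, one_mul]
    ring
  have hsecond := hderiv.unique ((hasDerivAt_const (0 : ℂ) (0 : ℂ)).congr_of_eventuallyEq
    (eventually_sum_mul_exp_mul_deriv_eq_zero hL h))
  simp only [mul_sub, Finset.sum_sub_distrib] at hsecond
  rw [Finset.sum_mul, sub_eq_zero.1 hsecond]
  exact Finset.sum_congr rfl fun i _ => mul_assoc _ _ _

end Exponent

section DominantRoot

variable {i₀ j₀ : ℕ} {t : ℕ → ℕ → ℝ} {r : ℝ}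

theorem HasMaxRoot.sum_tHat_div_pow (h : HasMaxRoot (charPoly i₀ j₀ t) r) :
    ∑ i ∈ Finset.Icc 1 i₀, tHat j₀ t i / r ^ i = 1 :=
  (isRoot_recPoly_iff h.1.ne').1 h.isRoot

/-- The common denominator of `C_μ` and `C_σ` is, up to a power of `r`, the derivative of the
characteristic polynomial at its simple root `r`. -/
theorem HasMaxRoot.sum_mul_div_pow_ne_zero (h : HasMaxRoot (charPoly i₀ j₀ t) r) :
    ∑ i ∈ Finset.Icc 1 i₀, ∑ j ∈ Finset.Icc 0 j₀, t i j * (i : ℝ) / r ^ i ≠ 0 := by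
  simp_rw [← Finset.sum_div, ← Finset.sum_mul]
  have hderiv := mul_eval_derivative_recPoly h.1.ne' h.isRoot
  exact right_ne_zero_of_mul (hderiv ▸ mul_ne_zero h.1.ne' h.eval_derivative_ne_zero)

/-- `r * exp (L s)` is an analytic branch, with value `r` at `s = 0`, of a root of the
characteristic equation `∑ t i j * exp (j * s) / x ^ i = 1` of the row generating functions. -/
structure IsRootExponent (i₀ j₀ : ℕ) (t : ℕ → ℕ → ℝ) (r : ℝ) (L : ℂ → ℂ) : Prop where
  analyticAt : AnalyticAt ℂ L 0
  map_zero : L 0 = 0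
  eventually_sum_eq_one : ∀ᶠ s in 𝓝 0, ∑ i ∈ Finset.Icc 1 i₀, ∑ j ∈ Finset.Icc 0 j₀,
    (t i j / r ^ i : ℂ) * Complex.exp (j * s - i * L s) = 1

theorem HasMaxRoot.exists_isRootExponent (hT : HasMaxRoot (charPoly i₀ j₀ t) r) :
    ∃ L : ℂ → ℂ, IsRootExponent i₀ j₀ t r L ∧
      deriv L 0 = Cmu i₀ j₀ t r ∧ deriv (deriv L) 0 = Csigma i₀ j₀ t r := by
  let S := Finset.Icc 1 i₀ ×ˢ Finset.Icc 0 j₀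
  let w (q : ℕ × ℕ) : ℂ := t q.1 q.2 / r ^ q.1
  have hsum (f : ℕ → ℕ → ℝ) : ∑ q ∈ S, w q * f q.1 q.2 =
      ((∑ i ∈ Finset.Icc 1 i₀, ∑ j ∈ Finset.Icc 0 j₀, t i j / r ^ i * f i j : ℝ) : ℂ) := by
    rw [Finset.sum_product]
    push_cast
    rfl
  have hw : ∑ q ∈ S, w q = 1 := by
    have h := hT.sum_tHat_div_pow
    simp only [tHat, Finset.sum_div] at h
    simpa [h] using hsum fun _ _ => 1
  have hα : ∑ q ∈ S, w q * ((q.1 : ℝ) : ℂ) ≠ 0 := by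
    have h := hT.sum_mul_div_pow_ne_zero
    simp only [mul_div_right_comm] at h
    refine (hsum fun i _ => i).trans_ne ?_
    exact_mod_cast h
  obtain ⟨L, hL, hL0, hL1⟩ :=
    exists_analyticAt_sum_mul_exp_eq_one (β := fun q : ℕ × ℕ => ((q.2 : ℝ) : ℂ)) hw hα
  have hm : deriv L 0 = Cmu i₀ j₀ t r := by
    rw [eq_div_of_mul_eq hα ((mul_comm _ _).trans (sum_mul_mul_deriv_exponent hL hL0 hL1)),
      hsum fun _ j => j, hsum fun i _ => i, ← Complex.ofReal_div, Cmu]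
    simp only [mul_div_right_comm]
  refine ⟨L, ⟨hL, hL0, ?_⟩, hm, ?_⟩
  · simpa [S, Finset.sum_product] using hL1
  · rw [eq_div_of_mul_eq hα ((mul_comm _ _).trans (sum_mul_mul_deriv_deriv_exponent hL hL0 hL1)),
      hm, hsum fun i _ => i, Csigma]
    have hvar := hsum fun i j => (j - Cmu i₀ j₀ t r * i) ^ 2
    push_cast at hvar ⊢
    simp only [hvar, mul_div_right_comm _ (_ : ℂ) (_ : ℂ)]

end DominantRoot

section UniformLimit

theorem exists_isBigO_sub_of_norm_succ_sub_le_geometric {Y E : Type*} [NormedAddCommGroup E]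
    [CompleteSpace E] {l : Filter Y} {v : ℕ → Y → E} {K γ : ℝ} (hγ : γ < 1)
    (hv : ∀ᶠ x in l, ∀ n, ‖v (n + 1) x - v n x‖ ≤ K * γ ^ n) :
    ∃ g : Y → E, (fun q : ℕ × Y => v q.1 q.2 - g q.2) =O[atTop ×ˢ l] fun q => γ ^ q.1 := by
  have hdist {x : Y} (hx : ∀ n, ‖v (n + 1) x - v n x‖ ≤ K * γ ^ n) (n : ℕ) :
      dist (v n x) (v (n + 1) x) ≤ K * γ ^ n := by
    rw [dist_comm, dist_eq_norm]
    exact hx n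
  refine ⟨fun x => limUnder atTop fun n => v n x, .of_bound (K / (1 - γ)) ?_⟩
  filter_upwards [hv.prod_inr atTop] with ⟨n, x⟩ hx
  have hlim := (cauchySeq_of_le_geometric γ K hγ (hdist hx)).tendsto_limUnder
  have htail := dist_le_of_le_geometric_of_tendsto γ K hγ (hdist hx) hlim n
  rw [dist_eq_norm, mul_div_right_comm] at htail
  refine htail.trans ?_
  have hK : 0 ≤ K := by simpa using (norm_nonneg _).trans (hx 0)
  gcongr
  exact le_abs_self _

variable {ι : Type*} {l : Filter ι} {f : ι → ℂ → ℂ} {g : ℂ → ℂ} {h : ι → ℝ} {z : ℂ}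

theorem tendsto_of_isBigO_prod (hh : Tendsto h l (𝓝 0))
    (hfg : (fun q : ι × ℂ => f q.1 q.2 - g q.2) =O[l ×ˢ 𝓝 z] fun q => h q.1)
    (hg : ContinuousAt g z) {s : ι → ℂ} (hs : Tendsto s l (𝓝 z)) :
    Tendsto (fun n => f n (s n)) l (𝓝 (g z)) := by
  have hdiff := (hfg.comp_tendsto (tendsto_id.prodMk hs)).trans_tendsto hh
  simpa [Function.comp_def] using hdiff.add (hg.tendsto.comp hs)

theorem exists_eventually_forall_mem_ball {P : ι × ℂ → Prop} (hP : ∀ᶠ q in l ×ˢ 𝓝 z, P q) :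
    ∃ R > 0, ∀ᶠ n in l, ∀ s ∈ Metric.ball z R, P (n, s) := by
  obtain ⟨pa, ha, pb, hb, hab⟩ := eventually_prod_iff.1 hP
  obtain ⟨R, hR, hball⟩ := Metric.eventually_nhds_iff_ball.1 hb
  exact ⟨R, hR, ha.mono fun n hn s hs => hab hn (hball s hs)⟩

theorem exists_differentiableOn_ball_of_isBigO_prod [l.NeBot]
    (hf : ∀ᶠ q : ι × ℂ in l ×ˢ 𝓝 z, AnalyticAt ℂ (f q.1) q.2) (hh : Tendsto h l (𝓝 0))
    (hfg : (fun q : ι × ℂ => f q.1 q.2 - g q.2) =O[l ×ˢ 𝓝 z] fun q => h q.1) :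
    ∃ C, ∃ R > 0, DifferentiableOn ℂ g (Metric.ball z R) ∧
      ∀ᶠ n in l, DifferentiableOn ℂ (f n) (Metric.ball z R) ∧
        ∀ s ∈ Metric.ball z R, ‖f n s - g s‖ ≤ C * ‖h n‖ := by
  obtain ⟨C, hC⟩ := hfg.bound
  obtain ⟨R, hR, hball⟩ := exists_eventually_forall_mem_ball (hf.and hC)
  have hdiff : ∀ᶠ n in l, DifferentiableOn ℂ (f n) (Metric.ball z R) :=
    hball.mono fun n hn s hs => (hn s hs).1.differentiableAt.differentiableWithinAt
  have hbound : ∀ᶠ n in l, ∀ s ∈ Metric.ball z R, ‖f n s - g s‖ ≤ C * ‖h n‖ :=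
    hball.mono fun n hn s hs => (hn s hs).2
  have hunif : TendstoUniformlyOn f g l (Metric.ball z R) := by
    refine Metric.tendstoUniformlyOn_iff.2 fun ε hε => ?_
    have hsmall : Tendsto (fun n => C * ‖h n‖) l (𝓝 0) := by simpa using hh.norm.const_mul C
    filter_upwards [hbound, hsmall.eventually_lt_const hε] with n hn hlt s hs
    rw [dist_comm, dist_eq_norm]
    exact (hn s hs).trans_lt hlt
  exact ⟨C, R, hR, hunif.tendstoLocallyUniformlyOn.differentiableOn hdiff Metric.isOpen_ball,
    hdiff.and hbound⟩

theorem analyticAt_of_isBigO_prod [l.NeBot]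
    (hf : ∀ᶠ q : ι × ℂ in l ×ˢ 𝓝 z, AnalyticAt ℂ (f q.1) q.2) (hh : Tendsto h l (𝓝 0))
    (hfg : (fun q : ι × ℂ => f q.1 q.2 - g q.2) =O[l ×ˢ 𝓝 z] fun q => h q.1) :
    AnalyticAt ℂ g z := by
  obtain ⟨_, R, hR, hg, _⟩ := exists_differentiableOn_ball_of_isBigO_prod hf hh hfg
  exact hg.analyticAt (Metric.ball_mem_nhds z hR)

theorem isBigO_deriv_sub_prod [l.NeBot]
    (hf : ∀ᶠ q : ι × ℂ in l ×ˢ 𝓝 z, AnalyticAt ℂ (f q.1) q.2) (hh : Tendsto h l (𝓝 0))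
    (hfg : (fun q : ι × ℂ => f q.1 q.2 - g q.2) =O[l ×ˢ 𝓝 z] fun q => h q.1) :
    (fun q : ι × ℂ => deriv (f q.1) q.2 - deriv g q.2) =O[l ×ˢ 𝓝 z] fun q => h q.1 := by
  obtain ⟨C, R, hR, hg, hball⟩ := exists_differentiableOn_ball_of_isBigO_prod hf hh hfg
  refine .of_bound (C / (R / 2)) ?_
  filter_upwards [hball.prod_mk (Metric.ball_mem_nhds z (half_pos hR))] with ⟨n, s⟩ ⟨⟨hfn, hn⟩, hs⟩
  have hsub : Metric.closedBall s (R / 2) ⊆ Metric.ball z R := by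
    refine Metric.closedBall_subset_ball' ?_
    linarith [Metric.mem_ball.1 hs]
  have hmem : s ∈ Metric.ball z R := hsub (Metric.mem_closedBall_self (half_pos hR).le)
  have hnhds := Metric.isOpen_ball.mem_nhds hmem
  rw [← deriv_sub (hfn.differentiableAt hnhds) (hg.differentiableAt hnhds), div_mul_eq_mul_div]
  exact Complex.norm_deriv_le_of_forall_mem_sphere_norm_le (half_pos hR)
    ((hfn.sub hg).diffContOnCl_ball hsub) fun w hw =>
      hn w (hsub (Metric.sphere_subset_closedBall hw))

end UniformLimit

section QuasiPowers

theorem deriv_mul_cexp_neg {M L : ℂ → ℂ} {z : ℂ} (b : ℂ) (hM : DifferentiableAt ℂ M z)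
    (hL : DifferentiableAt ℂ L z) :
    deriv (fun s => M s * Complex.exp (-(b * L s))) z =
      (deriv M z - b * deriv L z * M z) * Complex.exp (-(b * L z)) := by
  refine (hM.hasDerivAt.mul (hL.hasDerivAt.const_mul b).neg.cexp).deriv.trans ?_
  simp only [Pi.neg_apply]
  ring

theorem deriv_deriv_mul_cexp_neg {M L : ℂ → ℂ} {z : ℂ} (b : ℂ) (hM : AnalyticAt ℂ M z)
    (hL : AnalyticAt ℂ L z) :
    deriv (deriv fun s => M s * Complex.exp (-(b * L s))) z =
      (deriv (deriv M) z - 2 * (b * deriv L z) * deriv M z +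
        ((b * deriv L z) ^ 2 - b * deriv (deriv L) z) * M z) * Complex.exp (-(b * L z)) := by
  have hfirst : (deriv fun s => M s * Complex.exp (-(b * L s))) =ᶠ[𝓝 z]
      fun s => (deriv M s - b * deriv L s * M s) * Complex.exp (-(b * L s)) := by
    filter_upwards [hM.eventually_analyticAt, hL.eventually_analyticAt] with s hMs hLs
    exact deriv_mul_cexp_neg b hMs.differentiableAt hLs.differentiableAt
  have hM' := hM.deriv.differentiableAt
  have hbL := (hL.deriv.differentiableAt.hasDerivAt.const_mul b).mul hM.differentiableAt.hasDerivAt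
  refine hfirst.deriv_eq.trans <|
    (deriv_mul_cexp_neg b (hM'.sub hbL.differentiableAt) hL.differentiableAt).trans ?_
  rw [(hM'.hasDerivAt.sub hbL).deriv]
  simp only [Pi.sub_apply, Pi.mul_apply]
  ring

theorem deriv_complexMGF_zero {Ω : Type*} [MeasurableSpace Ω] {P : Measure Ω} {X : Ω → ℝ}
    (hX : 0 ∈ interior (integrableExpSet X P)) :
    deriv (complexMGF X P) 0 = (∫ ω, X ω ∂P : ℝ) := by
  simpa using (hasDerivAt_complexMGF (z := 0) (by simpa using hX)).deriv.trans
    (by simp [integral_complex_ofReal])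

theorem deriv_deriv_complexMGF_zero {Ω : Type*} [MeasurableSpace Ω] {P : Measure Ω}
    [IsProbabilityMeasure P] {X : Ω → ℝ} (hX : 0 ∈ interior (integrableExpSet X P)) :
    deriv (deriv (complexMGF X P)) 0 = (variance X P + (∫ ω, X ω ∂P) ^ 2 : ℝ) := by
  have hmoment : iteratedDeriv 2 (complexMGF X P) 0 = (∫ ω, X ω ^ 2 ∂P : ℝ) := by
    rw [iteratedDeriv_complexMGF (by simpa using hX)]
    simp [← integral_complex_ofReal]
  rw [variance_eq_sub (memLp_of_mem_interior_integrableExpSet hX 2), sub_add_cancel]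
  simpa [iteratedDeriv_succ] using hmoment

/-- The moment generating function of `X n` under `P n`, stripped of the exponential factor
`exp (β n * L s)`. -/
noncomputable def reducedMGF {Ω : ℕ → Type*} [∀ n, MeasurableSpace (Ω n)] (P : ∀ n, Measure (Ω n))
    (X : ∀ n, Ω n → ℝ) (β : ℕ → ℝ) (L : ℂ → ℂ) (n : ℕ) (s : ℂ) : ℂ :=
  complexMGF (X n) (P n) s * Complex.exp (-(β n * L s))

/-- Quasi-powers in the sense of Hwang: uniformly for complex `s` near the origin, the moment
generating function of `X n` under `P n` is `exp (β n * L s) * (g s + O (h n))`, with `L` analytic,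
`L 0 = 0` and `h n → 0`. -/
structure QuasiPowers {Ω : ℕ → Type*} [∀ n, MeasurableSpace (Ω n)] (P : ∀ n, Measure (Ω n))
    (X : ∀ n, Ω n → ℝ) (β : ℕ → ℝ) (L g : ℂ → ℂ) (h : ℕ → ℝ) : Prop where
  eventually_mem_interior : ∀ᶠ q : ℕ × ℂ in atTop ×ˢ 𝓝 0,
    q.2.re ∈ interior (integrableExpSet (X q.1) (P q.1))
  analyticAt_exponent : AnalyticAt ℂ L 0
  exponent_zero : L 0 = 0
  tendsto_error : Tendsto h atTop (𝓝 0)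
  isBigO_sub : (fun q : ℕ × ℂ => reducedMGF P X β L q.1 q.2 - g q.2) =O[atTop ×ˢ 𝓝 0] fun q => h q.1

namespace QuasiPowers

variable {Ω : ℕ → Type*} [∀ n, MeasurableSpace (Ω n)] {P : ∀ n, Measure (Ω n)}
  {X : ∀ n, Ω n → ℝ} {β : ℕ → ℝ} {L g : ℂ → ℂ} {h : ℕ → ℝ}

theorem eventually_analyticAt (hX : QuasiPowers P X β L g h) :
    ∀ᶠ q : ℕ × ℂ in atTop ×ˢ 𝓝 0, AnalyticAt ℂ (reducedMGF P X β L q.1) q.2 := by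
  filter_upwards [hX.eventually_mem_interior,
    hX.analyticAt_exponent.eventually_analyticAt.prod_inr atTop] with q hmem hL
  exact (analyticAt_complexMGF hmem).mul (analyticAt_const.mul hL).neg.cexp

theorem eventually_zero_mem_interior (hX : QuasiPowers P X β L g h) :
    ∀ᶠ n in atTop, 0 ∈ interior (integrableExpSet (X n) (P n)) := by
  simpa using hX.eventually_mem_interior.curry.mono fun n hn => hn.self_of_nhds

theorem analyticAt_factor (hX : QuasiPowers P X β L g h) : AnalyticAt ℂ g 0 :=
  analyticAt_of_isBigO_prod hX.eventually_analyticAt hX.tendsto_error hX.isBigO_sub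

variable [∀ n, IsProbabilityMeasure (P n)]

theorem factor_zero (hX : QuasiPowers P X β L g h) : g 0 = 1 := by
  have hlim := tendsto_of_isBigO_prod hX.tendsto_error hX.isBigO_sub
    hX.analyticAt_factor.continuousAt tendsto_const_nhds
  refine tendsto_nhds_unique hlim (tendsto_const_nhds.congr fun n => ?_)
  simp [reducedMGF, hX.exponent_zero, complexMGF]

theorem deriv_reducedMGF_zero (hX : QuasiPowers P X β L g h) : ∀ᶠ n in atTop,
    deriv (reducedMGF P X β L n) 0 = (∫ ω, X n ω ∂P n : ℝ) - β n * deriv L 0 := by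
  filter_upwards [hX.eventually_zero_mem_interior] with n hn
  have hM : AnalyticAt ℂ (complexMGF (X n) (P n)) 0 := analyticAt_complexMGF (by simpa using hn)
  refine (deriv_mul_cexp_neg _ hM.differentiableAt
    hX.analyticAt_exponent.differentiableAt).trans ?_
  simp [deriv_complexMGF_zero hn, hX.exponent_zero, complexMGF]

theorem deriv_deriv_reducedMGF_zero (hX : QuasiPowers P X β L g h) : ∀ᶠ n in atTop,
    deriv (deriv (reducedMGF P X β L n)) 0 = variance (X n) (P n) - β n * deriv (deriv L) 0 +
      ((∫ ω, X n ω ∂P n : ℝ) - β n * deriv L 0) ^ 2 := by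
  filter_upwards [hX.eventually_zero_mem_interior] with n hn
  have hM : AnalyticAt ℂ (complexMGF (X n) (P n)) 0 := analyticAt_complexMGF (by simpa using hn)
  have hM0 : complexMGF (X n) (P n) 0 = 1 := by simp [complexMGF]
  refine (deriv_deriv_mul_cexp_neg _ hM hX.analyticAt_exponent).trans ?_
  rw [deriv_complexMGF_zero hn, deriv_deriv_complexMGF_zero hn, hX.exponent_zero, hM0, mul_zero,
    neg_zero, Complex.exp_zero]
  push_cast
  ring

theorem isBigO_mean_sub (hX : QuasiPowers P X β L g h) :
    (fun n => ((∫ ω, X n ω ∂P n : ℝ) : ℂ) - β n * deriv L 0 - deriv g 0) =O[atTop] h := by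
  have hderiv := isBigO_deriv_sub_prod hX.eventually_analyticAt hX.tendsto_error hX.isBigO_sub
  refine (hderiv.comp_tendsto (tendsto_id.prodMk tendsto_const_nhds)).congr' ?_ .rfl
  exact hX.deriv_reducedMGF_zero.mono fun n hn => congrArg (· - deriv g 0) hn

theorem isBigO_variance_sub (hX : QuasiPowers P X β L g h) :
    (fun n => (variance (X n) (P n) : ℂ) - β n * deriv (deriv L) 0 -
      (deriv (deriv g) 0 - deriv g 0 ^ 2)) =O[atTop] h := by
  have hderiv := isBigO_deriv_sub_prod (f := fun n => deriv (reducedMGF P X β L n))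
    (hX.eventually_analyticAt.mono fun _ => AnalyticAt.deriv) hX.tendsto_error
    (isBigO_deriv_sub_prod hX.eventually_analyticAt hX.tendsto_error hX.isBigO_sub)
  have hmean := hX.isBigO_mean_sub
  have hsq : (fun n => (((∫ ω, X n ω ∂P n : ℝ) : ℂ) - β n * deriv L 0) ^ 2 - deriv g 0 ^ 2)
      =O[atTop] h := by
    have hsum := (hmean.trans_tendsto hX.tendsto_error).add_const (2 * deriv g 0)
    refine (hmean.mul (hsum.isBigO_one ℝ)).congr (fun n => ?_) fun n => mul_one _
    ring
  refine ((hderiv.comp_tendsto (tendsto_id.prodMk tendsto_const_nhds)).sub hsq).congr' ?_ .rfl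
  filter_upwards [hX.deriv_deriv_reducedMGF_zero] with n hn
  rw [Function.comp_apply, id_eq, hn]
  ring

end QuasiPowers

end QuasiPowers

section CentralLimit

theorem isLittleO_sub_taylor_two {L : ℂ → ℂ} (hL : AnalyticAt ℂ L 0) (hL0 : L 0 = 0) :
    (fun s => L s - (deriv L 0 * s + deriv (deriv L) 0 / 2 * s ^ 2)) =o[𝓝 0] fun s => s ^ 2 := by
  have hcube : (fun s : ℂ => ‖s‖ ^ 3) =o[𝓝 0] fun s => s ^ 2 := by
    have : (fun s : ℂ => s ^ 3) =o[𝓝 0] fun s => s ^ 2 := isLittleO_pow_pow (by norm_num)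
    simpa only [norm_pow] using this.norm_left
  refine ((hL.hasFPowerSeriesAt.isBigO_sub_partialSum_pow 3).trans_isLittleO hcube).congr_left
    fun s => ?_
  simp only [zero_add, FormalMultilinearSeries.partialSum,
    FormalMultilinearSeries.apply_eq_prod_smul_coeff, Finset.prod_const, Finset.card_univ,
    Fintype.card_fin, FormalMultilinearSeries.coeff_ofScalars, smul_eq_mul, Finset.sum_range_succ,
    Finset.range_one, Finset.sum_singleton, pow_zero, iteratedDeriv_zero, hL0, Nat.factorial_zero,
    Nat.cast_one, div_one, mul_zero, pow_one, iteratedDeriv_succ, Nat.factorial_one,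
    Nat.factorial_two, Nat.cast_ofNat, sub_right_inj]
  ring

theorem tendsto_mul_sub_deriv_mul {ι : Type*} {l : Filter ι} {L : ℂ → ℂ} (hL : AnalyticAt ℂ L 0)
    (hL0 : L 0 = 0) {b s : ι → ℂ} {w : ℂ} (hs : Tendsto s l (𝓝 0))
    (hbs : Tendsto (fun n => b n * s n ^ 2) l (𝓝 w)) :
    Tendsto (fun n => b n * (L (s n) - deriv L 0 * s n)) l (𝓝 (deriv (deriv L) 0 / 2 * w)) := by
  have hrem : Tendsto (fun n => b n * (L (s n) -
      (deriv L 0 * s n + deriv (deriv L) 0 / 2 * s n ^ 2))) l (𝓝 0) :=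
    (isLittleO_one_iff ℂ).1 <| ((isBigO_refl b l).mul_isLittleO
      ((isLittleO_sub_taylor_two hL hL0).comp_tendsto hs)).trans_isBigO (hbs.isBigO_one ℂ)
  simpa only [zero_add] using (hrem.add (hbs.const_mul (deriv (deriv L) 0 / 2))).congr
    fun n => by ring

theorem charFun_map_sub_const_div {Ω : Type*} [MeasurableSpace Ω] {P : Measure Ω} {X : Ω → ℝ}
    (hX : AEMeasurable X P) (m σ θ : ℝ) :
    charFun (P.map fun ω => (X ω - m) / σ) θ =
      complexMGF X P ((θ / σ : ℝ) * Complex.I) *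
        Complex.exp (-(m * ((θ / σ : ℝ) * Complex.I))) := by
  rw [← complexMGF_mul_I ((hX.sub_const m).div_const σ), complexMGF, complexMGF,
    ← integral_mul_const]
  refine integral_congr_ae (.of_forall fun ω => ?_)
  simp only [← Complex.exp_add]
  congr 1
  push_cast
  ring

theorem tendsto_div_sqrt_mul_I {ι : Type*} {l : Filter ι} {V : ι → ℝ} (hV : Tendsto V l atTop)
    (θ : ℝ) : Tendsto (fun n => ((θ / Real.sqrt (V n) : ℝ) : ℂ) * Complex.I) l (𝓝 0) := by
  have hdiv := (Real.tendsto_sqrt_atTop.comp hV).const_div_atTop θ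
  simpa using (tendsto_ofReal_iff.2 hdiv).mul_const Complex.I

theorem tendsto_mul_div_sqrt_mul_I_sq {ι : Type*} {l : Filter ι} {V b : ι → ℝ} {v : ℝ}
    (hV : Tendsto V l atTop) (hVb : Tendsto (fun n => V n / b n) l (𝓝 v)) (hv : v ≠ 0) (θ : ℝ) :
    Tendsto (fun n => (b n : ℂ) * ((θ / Real.sqrt (V n) : ℝ) * Complex.I) ^ 2) l
      (𝓝 (-(θ ^ 2 / v))) := by
  have hreal : Tendsto (fun n => ((-(θ ^ 2 * (V n / b n)⁻¹) : ℝ) : ℂ)) l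
      (𝓝 (-(θ ^ 2 * v⁻¹) : ℝ)) :=
    tendsto_ofReal_iff.2 ((hVb.inv₀ hv).const_mul _).neg
  push_cast at hreal
  refine hreal.congr' ?_
  filter_upwards [hV.eventually_ge_atTop 0] with n hn
  have hsq : ((Real.sqrt (V n) : ℝ) : ℂ) ^ 2 = V n := by exact_mod_cast Real.sq_sqrt hn
  push_cast
  rw [mul_pow, div_pow, hsq, Complex.I_sq, inv_div]
  ring

namespace QuasiPowers

variable {Ω : ℕ → Type*} [∀ n, MeasurableSpace (Ω n)] {P : ∀ n, Measure (Ω n)}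
  [∀ n, IsProbabilityMeasure (P n)] {X : ∀ n, Ω n → ℝ} {β : ℕ → ℝ} {L g : ℂ → ℂ} {h : ℕ → ℝ} {v : ℝ}

theorem tendsto_variance_div (hX : QuasiPowers P X β L g h) (hβ : Tendsto β atTop atTop)
    (hv : deriv (deriv L) 0 = v) :
    Tendsto (fun n => variance (X n) (P n) / β n) atTop (𝓝 v) := by
  rw [← tendsto_ofReal_iff]
  have hβinv : Tendsto (fun n => ((β n)⁻¹ : ℂ)) atTop (𝓝 0) := by
    simpa using tendsto_ofReal_iff.2 hβ.inv_tendsto_atTop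
  have hdiff := (hX.isBigO_variance_sub.trans_tendsto hX.tendsto_error).add_const
    (deriv (deriv g) 0 - deriv g 0 ^ 2)
  have hquot := (hdiff.mul hβinv).add_const (v : ℂ)
  rw [mul_zero, zero_add] at hquot
  refine hquot.congr' ?_
  filter_upwards [hβ.eventually_ne_atTop 0] with n hn
  have hn' : (β n : ℂ) ≠ 0 := by exact_mod_cast hn
  rw [hv]
  push_cast
  field_simp
  ring

theorem tendstoInDistribution (hX : QuasiPowers P X β L g h) (hXm : ∀ n, AEMeasurable (X n) (P n))
    (hβ : Tendsto β atTop atTop) (hv : deriv (deriv L) 0 = v) (hv0 : 0 < v) :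
    TendstoInDistribution
      (fun n ω => (X n ω - ∫ ω', X n ω' ∂P n) / Real.sqrt (variance (X n) (P n)))
      atTop (id : ℝ → ℝ) P (gaussianReal 0 1) := by
  refine ⟨fun n => ((hXm n).sub_const _).div_const _, aemeasurable_id,
    ProbabilityMeasure.tendsto_iff_tendsto_charFun.2 fun θ => ?_⟩
  have hVβ := hX.tendsto_variance_div hβ hv
  have hV : Tendsto (fun n => variance (X n) (P n)) atTop atTop := by
    refine (hVβ.pos_mul_atTop hv0 hβ).congr' ?_
    filter_upwards [hβ.eventually_ne_atTop 0] with n hn using div_mul_cancel₀ _ hn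
  set s : ℕ → ℂ := fun n => (θ / Real.sqrt (variance (X n) (P n)) : ℝ) * Complex.I
  have hs : Tendsto s atTop (𝓝 0) := tendsto_div_sqrt_mul_I hV θ
  have hfactor : Tendsto (fun n => reducedMGF P X β L n (s n)) atTop (𝓝 1) :=
    hX.factor_zero ▸ tendsto_of_isBigO_prod hX.tendsto_error hX.isBigO_sub
      hX.analyticAt_factor.continuousAt hs
  have hdrift : Tendsto (fun n => (((∫ ω, X n ω ∂P n : ℝ) : ℂ) - β n * deriv L 0) * s n)
      atTop (𝓝 0) := by
    have hmean := (hX.isBigO_mean_sub.trans_tendsto hX.tendsto_error).add_const (deriv g 0)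
    simpa using hmean.mul hs
  have hexponent := (tendsto_mul_sub_deriv_mul hX.analyticAt_exponent hX.exponent_zero hs
    (tendsto_mul_div_sqrt_mul_I_sq hV hVβ hv0.ne' θ)).sub hdrift
  have hlim := hfactor.mul ((Complex.continuous_exp.tendsto _).comp hexponent)
  have hgauss : charFun (gaussianReal 0 1) θ =
      1 * Complex.exp (deriv (deriv L) 0 / 2 * -(θ ^ 2 / v) - 0) := by
    have hvc : (v : ℂ) ≠ 0 := by exact_mod_cast hv0.ne'
    rw [charFun_gaussianReal, one_mul, hv]
    congr 1
    simp only [Complex.ofReal_zero, mul_zero, zero_mul, NNReal.coe_one, Complex.ofReal_one, one_mul,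
      zero_sub, mul_neg, sub_zero, neg_inj]
    field_simp
  rw [ProbabilityMeasure.coe_mk, Measure.map_id, hgauss]
  refine hlim.congr fun n => ?_
  rw [ProbabilityMeasure.coe_mk, charFun_map_sub_const_div (hXm n), reducedMGF, mul_assoc,
    Function.comp_apply, ← Complex.exp_add]
  congr 2
  ring

end QuasiPowers

end CentralLimit

section RowGF

theorem tsum_natCast_of_neg {E : Type*} [AddCommMonoid E] [TopologicalSpace E] {g : ℤ → E}
    (hg : ∀ k < 0, g k = 0) : ∑' k : ℕ, g k = ∑' k : ℤ, g k :=
  Nat.cast_injective.tsum_eq fun k hk =>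
    ⟨k.toNat, Int.toNat_of_nonneg (not_lt.1 fun h => hk (hg k h))⟩

/-- The bilateral exponential generating sum `∑ₖ f k * exp (k * s)` of a sequence `f`. It is only
used for `f` of finite support, where the series is a finite sum. -/
noncomputable def rowGF (f : ℤ → ℝ) (s : ℂ) : ℂ :=
  ∑' k : ℤ, (f k : ℂ) * Complex.exp (k * s)

theorem hasSum_rowGF {f : ℤ → ℝ} (hf : f.support.Finite) (s : ℂ) :
    HasSum (fun k : ℤ => (f k : ℂ) * Complex.exp (k * s)) (rowGF f s) := by
  refine (summable_of_hasFiniteSupport (hf.subset fun k hk => ?_)).hasSum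
  exact fun hk0 => hk (by simp [hk0])

theorem differentiable_rowGF {f : ℤ → ℝ} (hf : f.support.Finite) : Differentiable ℂ (rowGF f) := by
  have hsum : rowGF f = fun s => ∑ k ∈ hf.toFinset, (f k : ℂ) * Complex.exp (k * s) := by
    ext s
    exact tsum_eq_sum fun k hk => by
      rw [Set.Finite.mem_toFinset, Function.notMem_support] at hk
      simp [hk]
  rw [hsum]
  fun_prop

theorem rowGF_zero {f : ℤ → ℝ} (hneg : ∀ k < 0, f k = 0) :
    rowGF f 0 = (∑' k : ℕ, f k : ℝ) := by
  simp only [rowGF, mul_zero, Complex.exp_zero, mul_one]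
  rw [← tsum_natCast_of_neg fun k hk => by rw [hneg k hk, Complex.ofReal_zero], Complex.ofReal_tsum]

theorem hasSum_rowGF_comp_sub {f : ℤ → ℝ} (hf : f.support.Finite) (j : ℤ) (s : ℂ) :
    HasSum (fun k : ℤ => (f (k - j) : ℂ) * Complex.exp (k * s))
      (Complex.exp (j * s) * rowGF f s) := by
  refine (((Equiv.subRight j).hasSum_iff.2 (hasSum_rowGF hf s)).mul_left
    (Complex.exp (j * s))).congr_fun fun k => ?_
  rw [Function.comp_apply, Equiv.subRight_apply, mul_left_comm, ← Complex.exp_add]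
  push_cast
  ring_nf

end RowGF

section FiniteLaw

variable {Ω : Type*} [MeasurableSpace Ω] {P : Measure Ω} [IsFiniteMeasure P] {X : Ω → ℕ}
  {f : ℤ → ℝ} {R : ℝ}

theorem ae_apply_ne_zero (hX : ∀ k : ℕ, P.real {ω | X ω = k} = f k / R) :
    ∀ᵐ ω ∂P, f (X ω) ≠ 0 := by
  have hzero (k : ℕ) (hk : f k = 0) : ∀ᵐ ω ∂P, X ω ≠ k := by
    have hnull : P {ω | X ω = k} = 0 := by
      rw [← measureReal_eq_zero_iff, hX k, hk, zero_div]
    exact measure_eq_zero_iff_ae_notMem.1 hnull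
  filter_upwards [ae_all_iff.2 fun k => eventually_imp_distrib_left.2 (hzero k)] with ω hω hf
  exact hω (X ω) hf rfl

theorem integrable_comp_of_finite_support {E : Type*} [NormedAddCommGroup E] (hXm : Measurable X)
    (hf : f.support.Finite) (hX : ∀ k : ℕ, P.real {ω | X ω = k} = f k / R) (F : ℕ → E) :
    Integrable (fun ω => F (X ω)) P := by
  obtain ⟨C, hC⟩ := ((hf.preimage Nat.cast_injective.injOn).image fun k : ℕ => ‖F k‖).bddAbove
  refine .of_bound (AEStronglyMeasurable.of_discrete.comp_measurable hXm) C ?_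
  filter_upwards [ae_apply_ne_zero hX] with ω hω
  exact hC ⟨X ω, hω, rfl⟩

theorem integrableExpSet_eq_univ (hXm : Measurable X) (hf : f.support.Finite)
    (hX : ∀ k : ℕ, P.real {ω | X ω = k} = f k / R) :
    integrableExpSet (fun ω => (X ω : ℝ)) P = Set.univ :=
  Set.eq_univ_of_forall fun t =>
    integrable_comp_of_finite_support hXm hf hX fun k => Real.exp (t * k)

theorem complexMGF_eq_rowGF_div (hXm : Measurable X) (hf : f.support.Finite)
    (hneg : ∀ k < 0, f k = 0) (hX : ∀ k : ℕ, P.real {ω | X ω = k} = f k / R) (s : ℂ) :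
    complexMGF (fun ω => (X ω : ℝ)) P s = rowGF f s / R := by
  have hint : Integrable (fun k : ℕ => Complex.exp (s * k)) (P.map X) :=
    (integrable_map_measure .of_discrete hXm.aemeasurable).2 <|
      integrable_comp_of_finite_support hXm hf hX fun k => Complex.exp (s * k)
  calc complexMGF (fun ω => (X ω : ℝ)) P s
      = ∫ k, Complex.exp (s * k) ∂(P.map X) :=
        (integral_map (f := fun k : ℕ => Complex.exp (s * k)) hXm.aemeasurable .of_discrete).symm
    _ = ∑' k : ℕ, (f k : ℂ) * Complex.exp (k * s) / R := by
      rw [integral_countable hint]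
      refine tsum_congr fun k => ?_
      rw [map_measureReal_apply hXm (.singleton k)]
      refine (congrArg (· • Complex.exp (s * k)) (hX k)).trans ?_
      rw [Complex.real_smul, Complex.ofReal_div, mul_comm s, div_mul_eq_mul_div]
    _ = rowGF f s / R := by
      rw [tsum_div_const, rowGF, ← tsum_natCast_of_neg fun k hk => by simp [hneg k hk]]
      rfl

end FiniteLaw

section Rows

/-- From the row `n₀` on, `p` obeys the two-dimensional recurrence with coefficients `t`. -/
def IsRowRecurrence (i₀ j₀ : ℕ) (n₀ : ℤ) (t : ℕ → ℕ → ℝ) (p : ℤ → ℤ → ℝ) : Prop :=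
  ∀ n k : ℤ, n₀ ≤ n →
    p n k = ∑ i ∈ Finset.Icc 1 i₀, ∑ j ∈ Finset.Icc 0 j₀, t i j * p (n - (i : ℤ)) (k - (j : ℤ))

/-- The generating function of the row `p n`, stripped of the exponential factor `exp (n * L s)`. -/
noncomputable def reducedRowGF (p : ℤ → ℤ → ℝ) (L : ℂ → ℂ) (n : ℤ) (s : ℂ) : ℂ :=
  rowGF (p n) s * Complex.exp (-(n * L s))

/-- The coefficients of the one-dimensional recurrence satisfied by `reducedRowGF p L · s`. -/
noncomputable def reducedCoeff (j₀ : ℕ) (t : ℕ → ℕ → ℝ) (L : ℂ → ℂ) (s : ℂ) (i : ℕ) : ℂ :=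
  ∑ j ∈ Finset.Icc 0 j₀, t i j * Complex.exp (j * s - i * L s)

variable {i₀ j₀ : ℕ} {t : ℕ → ℕ → ℝ} {p : ℤ → ℤ → ℝ} {L : ℂ → ℂ} {r : ℝ}

theorem IsRowRecurrence.finite_support_add {n₀ : ℤ} (h : IsRowRecurrence i₀ j₀ n₀ t p)
    (hfin : ∀ n < n₀, (p n).support.Finite) (m : ℕ) :
    ∀ n < n₀ + m, (p n).support.Finite := by
  induction m with
  | zero => simpa using hfin
  | succ m ih =>
    intro n hn
    rcases lt_or_ge n n₀ with hlt | hge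
    · exact hfin n hlt
    have hshift (i : ℕ) (hi : 1 ≤ i) (j : ℕ) : {k : ℤ | p (n - i) (k - j) ≠ 0}.Finite :=
      (ih (n - i) (by omega)).preimage sub_left_injective.injOn
    refine (Set.finite_iUnion fun i : Finset.Icc 1 i₀ => Set.finite_iUnion
      fun j : Finset.Icc 0 j₀ => hshift i (Finset.mem_Icc.1 i.2).1 j).subset fun k hk => ?_
    rw [Function.mem_support, h n k hge] at hk
    obtain ⟨i, hi, hk⟩ := Finset.exists_ne_zero_of_sum_ne_zero hk
    obtain ⟨j, hj, hk⟩ := Finset.exists_ne_zero_of_sum_ne_zero hk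
    exact Set.mem_iUnion₂.2 ⟨⟨i, hi⟩, ⟨j, hj⟩, right_ne_zero_of_mul hk⟩

theorem IsRowRecurrence.finite_support {n₀ : ℤ} (h : IsRowRecurrence i₀ j₀ n₀ t p)
    (hfin : ∀ n < n₀, (p n).support.Finite) (n : ℤ) : (p n).support.Finite :=
  h.finite_support_add hfin (n - n₀ + 1).toNat n (by omega)

theorem IsRowRecurrence.rowGF_eq_sum {n₀ : ℤ} (h : IsRowRecurrence i₀ j₀ n₀ t p)
    (hfin : ∀ n, (p n).support.Finite) {n : ℤ} (hn : n₀ ≤ n) (s : ℂ) :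
    rowGF (p n) s = ∑ i ∈ Finset.Icc 1 i₀, ∑ j ∈ Finset.Icc 0 j₀,
      t i j * (Complex.exp (j * s) * rowGF (p (n - i)) s) := by
  have hsum := hasSum_sum fun i (_ : i ∈ Finset.Icc 1 i₀) =>
    hasSum_sum fun j (_ : j ∈ Finset.Icc 0 j₀) =>
      (hasSum_rowGF_comp_sub (hfin (n - i)) j s).mul_left (t i j : ℂ)
  simp only [Int.cast_natCast] at hsum
  refine HasSum.unique ((hasSum_rowGF (hfin n) s).congr_fun fun k => ?_) hsum
  rw [h n k hn]
  push_cast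
  simp only [Finset.sum_mul, mul_assoc]

theorem IsRowRecurrence.reducedRowGF_eq_sum {n₀ : ℤ} (h : IsRowRecurrence i₀ j₀ n₀ t p)
    (hfin : ∀ n, (p n).support.Finite) {n : ℤ} (hn : n₀ ≤ n) (s : ℂ) :
    reducedRowGF p L n s =
      ∑ i ∈ Finset.Icc 1 i₀, reducedCoeff j₀ t L s i * reducedRowGF p L (n - i) s := by
  simp only [reducedRowGF, reducedCoeff, h.rowGF_eq_sum hfin hn s, Finset.sum_mul]
  refine Finset.sum_congr rfl fun i _ => Finset.sum_congr rfl fun j _ => ?_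
  have hexp : Complex.exp (j * s - i * L s) * Complex.exp (-((n - i : ℤ) * L s)) =
      Complex.exp (j * s) * Complex.exp (-(n * L s)) := by
    rw [← Complex.exp_add, ← Complex.exp_add]
    push_cast
    ring_nf
  linear_combination (-(t i j : ℂ) * rowGF (p (n - i)) s) * hexp

theorem analyticAt_reducedRowGF {n : ℤ} (hfin : (p n).support.Finite)
    {s : ℂ} (hL : AnalyticAt ℂ L s) : AnalyticAt ℂ (reducedRowGF p L n) s :=
  ((differentiable_rowGF hfin).analyticAt s).mul (analyticAt_const.mul hL).neg.cexp

theorem recPoly_reducedCoeff_zero (hL0 : L 0 = 0) :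
    recPoly i₀ (reducedCoeff j₀ t L 0) = (charPoly i₀ j₀ t).map Complex.ofRealHom := by
  rw [show charPoly i₀ j₀ t = recPoly i₀ (tHat j₀ t) from rfl, map_recPoly]
  congr 1
  ext i
  simp [reducedCoeff, tHat, hL0]

theorem isRoot_recPoly_reducedCoeff (hr : r ≠ 0) {s : ℂ}
    (hs : ∑ i ∈ Finset.Icc 1 i₀, ∑ j ∈ Finset.Icc 0 j₀,
      (t i j / r ^ i : ℂ) * Complex.exp (j * s - i * L s) = 1) :
    (recPoly i₀ (reducedCoeff j₀ t L s)).IsRoot (r : ℂ) := by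
  rw [isRoot_recPoly_iff (Complex.ofReal_ne_zero.2 hr), ← hs]
  simp only [reducedCoeff, Finset.sum_div, div_mul_eq_mul_div]

theorem IsRowRecurrence.exists_norm_reducedRowGF_succ_sub_le {n₀ : ℤ}
    (h : IsRowRecurrence i₀ j₀ n₀ t p) (hfin : ∀ n, (p n).support.Finite)
    (hT : HasMaxRoot (charPoly i₀ j₀ t) r) (hL : IsRootExponent i₀ j₀ t r L) :
    ∃ K γ : ℝ, 0 < γ ∧ γ < r ∧ ∀ᶠ s in 𝓝 0, ∀ n : ℕ,
      ‖reducedRowGF p L (n₀ + (n + 1 : ℕ)) s - r * reducedRowGF p L (n₀ + n) s‖ ≤ K * γ ^ n := by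
  have hLcont := hL.analyticAt.continuousAt
  have hcoeff (i : ℕ) : ContinuousAt (fun s => reducedCoeff j₀ t L s i) 0 := by
    unfold reducedCoeff
    fun_prop
  refine exists_eventually_norm_succ_sub_mul_le (ρ := ⟨r, hT.1.le⟩) (r := r) hT.1
    (Q := fun s => recPoly i₀ (reducedCoeff j₀ t L s))
    (u := fun s n => reducedRowGF p L (n₀ + n) s) (fun s => monic_recPoly _ _)
    (fun s => natDegree_recPoly _ _) (continuousAt_coeff_recPoly hcoeff i₀)
    (hL.eventually_sum_eq_one.mono fun s => isRoot_recPoly_reducedCoeff hT.1.ne') (fun z hz => ?_)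
    (.of_forall fun s => aeval_shift_recPoly_eq_zero fun n hn => ?_)
    fun i _ => (analyticAt_reducedRowGF (hfin _) hL.analyticAt).continuousAt
  · rw [recPoly_reducedCoeff_zero hL.map_zero] at hz
    exact hT.norm_lt_of_isRoot_divByMonic hz
  · rw [h.reducedRowGF_eq_sum hfin (by omega)]
    refine Finset.sum_congr rfl fun i hi => ?_
    rw [Nat.cast_sub ((Finset.mem_Icc.1 hi).2.trans hn), add_sub_assoc]

theorem exists_isBigO_div_pow_sub_of_norm_succ_sub_mul_le {Y E : Type*} [NormedField E]
    [CompleteSpace E] {l : Filter Y} {v : ℕ → Y → E} {K γ : ℝ} {r : E} (hr : r ≠ 0) (hγ : γ < ‖r‖)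
    (hv : ∀ᶠ x in l, ∀ n, ‖v (n + 1) x - r * v n x‖ ≤ K * γ ^ n) :
    ∃ g : Y → E, (fun q : ℕ × Y => v q.1 q.2 / r ^ q.1 - g q.2) =O[atTop ×ˢ l]
      fun q => (γ / ‖r‖) ^ q.1 := by
  have hr0 := norm_pos_iff.2 hr
  refine exists_isBigO_sub_of_norm_succ_sub_le_geometric (K := K / ‖r‖)
    (v := fun n x => v n x / r ^ n) ((div_lt_one hr0).2 hγ) ?_
  filter_upwards [hv] with x hx n
  have hdiv : v (n + 1) x / r ^ (n + 1) - v n x / r ^ n =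
      (v (n + 1) x - r * v n x) / r ^ (n + 1) := by
    field_simp
    ring
  rw [hdiv, norm_div, norm_pow, div_pow, div_mul_div_comm, ← pow_succ']
  gcongr
  exact hx n

theorem IsRowRecurrence.exists_isBigO_reducedRowGF_div_sub {n₀ : ℕ}
    (h : IsRowRecurrence i₀ j₀ n₀ t p) (hfin : ∀ n, (p n).support.Finite)
    (hT : HasMaxRoot (charPoly i₀ j₀ t) r) (hL : IsRootExponent i₀ j₀ t r L) :
    ∃ (c : ℂ → ℂ) (γ : ℝ), 0 < γ ∧ γ < 1 ∧
      (fun q : ℕ × ℂ => reducedRowGF p L q.1 q.2 / r ^ q.1 - c q.2) =O[atTop ×ˢ 𝓝 0]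
        fun q => γ ^ q.1 := by
  obtain ⟨K, γ, hγ0, hγr, hK⟩ := h.exists_norm_reducedRowGF_succ_sub_le hfin hT hL
  have hr : (r : ℂ) ≠ 0 := Complex.ofReal_ne_zero.2 hT.1.ne'
  have hnorm : ‖(r : ℂ)‖ = r := by rw [Complex.norm_real, Real.norm_of_nonneg hT.1.le]
  obtain ⟨c, hc⟩ := exists_isBigO_div_pow_sub_of_norm_succ_sub_mul_le
    (v := fun (n : ℕ) s => reducedRowGF p L (n₀ + n) s) hr (hnorm.symm ▸ hγr) hK
  rw [hnorm] at hc
  refine ⟨fun s => c s / r ^ n₀, γ / r, div_pos hγ0 hT.1, (div_lt_one hT.1).2 hγr, ?_⟩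
  rw [← map_add_atTop_eq_nat n₀, ← Filter.map_id (f := 𝓝 (0 : ℂ)), prod_map_map_eq, isBigO_map]
  have hpow : (fun q : ℕ × ℂ => (γ / r) ^ q.1) =O[atTop ×ˢ 𝓝 0] fun q => (γ / r) ^ (q.1 + n₀) := by
    simp only [pow_add, mul_comm _ ((γ / r) ^ n₀)]
    exact isBigO_self_const_mul (pow_ne_zero n₀ (div_pos hγ0 hT.1).ne') _ _
  refine ((hc.const_mul_left ((r : ℂ) ^ n₀)⁻¹).congr_left fun q => ?_).trans hpow
  simp only [Function.comp_apply, id_eq, Nat.cast_add, pow_add, add_comm (q.1 : ℤ)]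
  field_simp

end Rows

section RowLaws

theorem isBigO_div_sub_div_prod {ι : Type*} {l : Filter ι} {a : ι → ℂ → ℂ} {c : ℂ → ℂ} {h : ι → ℝ}
    {z : ℂ} (hac : (fun q : ι × ℂ => a q.1 q.2 - c q.2) =O[l ×ˢ 𝓝 z] fun q => h q.1)
    (hh : Tendsto h l (𝓝 0)) (hc : ContinuousAt c z) (hcz : c z ≠ 0) :
    (fun q : ι × ℂ => a q.1 q.2 / a q.1 z - c q.2 / c z) =O[l ×ˢ 𝓝 z] fun q => h q.1 := by
  have hlim : Tendsto (fun q : ι × ℂ => a q.1 z) (l ×ˢ 𝓝 z) (𝓝 (c z)) :=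
    (tendsto_of_isBigO_prod hh hac hc tendsto_const_nhds).comp tendsto_fst
  have hacz : (fun q : ι × ℂ => a q.1 z - c z) =O[l ×ˢ 𝓝 z] fun q => h q.1 :=
    hac.comp_tendsto (tendsto_fst.prodMk tendsto_const_nhds)
  have hcdiv : (fun q : ι × ℂ => c q.2 / c z) =O[l ×ˢ 𝓝 z] fun _ => (1 : ℝ) :=
    ((hc.div_const (c z)).tendsto.comp tendsto_snd).isBigO_one ℝ
  have hbound := ((hlim.inv₀ hcz).isBigO_one ℝ).mul (hac.sub ((hcdiv.mul hacz).congr_right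
    fun q => one_mul (h q.1)))
  refine (hbound.congr_right fun q => one_mul (h q.1)).congr' ?_ .rfl
  filter_upwards [hlim.eventually_ne hcz] with q hq
  field_simp
  ring

theorem ne_zero_of_tendsto_div_of_isBigO {ι 𝕜 : Type*} [NormedField 𝕜] {l : Filter ι} [l.NeBot]
    {f g : ι → 𝕜} {c : 𝕜} (hg : ∀ n, g n ≠ 0) (hgf : g =O[l] f)
    (hlim : Tendsto (fun n => f n / g n) l (𝓝 c)) : c ≠ 0 := by
  rintro rfl
  exact isLittleO_irrefl (.of_forall hg) <|
    hgf.trans_isLittleO ((isLittleO_iff_tendsto fun n hn => (hg n hn).elim).2 hlim)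

theorem isBigO_sub_add_re {ι : Type*} {l : Filter ι} {f : ι → ℝ} {h : ι → ℝ} {b : ι → ℝ} {a : ℝ}
    {c : ℂ} (hf : (fun n => (f n : ℂ) - b n * a - c) =O[l] h) :
    (fun n => f n - (a * b n + c.re)) =O[l] h := by
  have hre (n : ι) : ‖f n - (a * b n + c.re)‖ ≤ ‖(f n : ℂ) - b n * a - c‖ := by
    convert Complex.abs_re_le_norm ((f n : ℂ) - b n * a - c) using 1
    simp [sub_add_eq_sub_sub, mul_comm a]
  exact (IsBigO.of_norm_le hre).trans hf.norm_left

variable {i₀ j₀ n₀ : ℕ} {t : ℕ → ℕ → ℝ} {p : ℤ → ℤ → ℝ} {L : ℂ → ℂ} {r : ℝ}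

theorem reducedRowGF_zero {n : ℕ} (hneg : ∀ k < 0, p n k = 0) (hL0 : L 0 = 0) :
    reducedRowGF p L n 0 = rowSum p n := by
  simp [reducedRowGF, hL0, rowGF_zero hneg, rowSum]

variable {Ω : ℕ → Type*} [∀ n, MeasurableSpace (Ω n)] {P : ∀ n, Measure (Ω n)}
  [∀ n, IsProbabilityMeasure (P n)] {X : ∀ n, Ω n → ℕ}

theorem reducedMGF_eq_reducedRowGF_div (hX_meas : ∀ n, Measurable (X n))
    {n : ℕ} (hfin : (p n).support.Finite) (hneg : ∀ k < 0, p n k = 0)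
    (hX : ∀ k : ℕ, (P n).real {ω | X n ω = k} = p n k / rowSum p n) (s : ℂ) :
    reducedMGF P (fun n ω => (X n ω : ℝ)) (fun n => n) L n s =
      reducedRowGF p L n s / rowSum p n := by
  rw [reducedMGF, complexMGF_eq_rowGF_div (hX_meas n) hfin hneg hX, reducedRowGF,
    div_mul_eq_mul_div]
  push_cast
  rfl

theorem IsRowRecurrence.exists_quasiPowers (h : IsRowRecurrence i₀ j₀ n₀ t p)
    (hfin : ∀ n, (p n).support.Finite) (hneg : ∀ (n : ℕ), ∀ k < 0, p n k = 0)
    (hgrowth : (fun n : ℕ => r ^ n) =O[atTop] rowSum p)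
    (hT : HasMaxRoot (charPoly i₀ j₀ t) r) (hL : IsRootExponent i₀ j₀ t r L)
    (hX_meas : ∀ n, Measurable (X n))
    (hX : ∀ n : ℕ, rowSum p n ≠ 0 →
      ∀ k : ℕ, (P n).real {ω | X n ω = k} = p n k / rowSum p n) :
    ∃ (g : ℂ → ℂ) (γ : ℝ), 0 < γ ∧ γ < 1 ∧
      QuasiPowers P (fun n ω => (X n ω : ℝ)) (fun n => n) L g fun n => γ ^ n := by
  obtain ⟨c, γ, hγ0, hγ1, hc⟩ := h.exists_isBigO_reducedRowGF_div_sub hfin hT hL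
  have hγ := tendsto_pow_atTop_nhds_zero_of_lt_one hγ0.le hγ1
  have hr (n : ℕ) : (r : ℂ) ^ n ≠ 0 := pow_ne_zero n (Complex.ofReal_ne_zero.2 hT.1.ne')
  have hanalytic : ∀ᶠ q : ℕ × ℂ in atTop ×ˢ 𝓝 0,
      AnalyticAt ℂ (fun s => reducedRowGF p L q.1 s / r ^ q.1) q.2 :=
    (hL.analyticAt.eventually_analyticAt.prod_inr atTop).mono fun q hq =>
      (analyticAt_reducedRowGF (hfin q.1) hq).div analyticAt_const (hr q.1)
  have hcont : ContinuousAt c 0 := (analyticAt_of_isBigO_prod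
    (f := fun (n : ℕ) s => reducedRowGF p L n s / r ^ n) hanalytic hγ hc).continuousAt
  have hlim := tendsto_of_isBigO_prod
    (f := fun (n : ℕ) s => reducedRowGF p L n s / r ^ n) hγ hc hcont tendsto_const_nhds
  simp only [reducedRowGF_zero (hneg _) hL.map_zero] at hlim
  have hc0 : c 0 ≠ 0 := by
    refine ne_zero_of_tendsto_div_of_isBigO hr (.of_norm_norm ?_) hlim
    simpa [← Complex.ofReal_pow] using hgrowth.norm_norm
  have hrow : ∀ᶠ n in atTop, rowSum p n ≠ 0 := (hlim.eventually_ne hc0).mono fun n hn => by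
    simpa [(hr n)] using hn
  refine ⟨fun s => c s / c 0, γ, hγ0, hγ1, ?_, hL.analyticAt, hL.map_zero, hγ, ?_⟩
  · filter_upwards [hrow.prod_inl (𝓝 0)] with q hq
    simp [integrableExpSet_eq_univ (hX_meas q.1) (hfin q.1) (hX q.1 hq)]
  · refine (isBigO_div_sub_div_prod (a := fun (n : ℕ) s => reducedRowGF p L n s / r ^ n)
      hc hγ hcont hc0).congr' ?_ .rfl
    filter_upwards [hrow.prod_inl (𝓝 0)] with q hq
    rw [div_div_div_cancel_right₀ (hr q.1), reducedRowGF_zero (hneg q.1) hL.map_zero,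
      reducedMGF_eq_reducedRowGF_div hX_meas (hfin q.1) (hneg q.1) (hX q.1 hq)]

end RowLaws

end TwoDimRec

theorem theorem2p6_general
    (i₀ j₀ n₀ : ℕ)
    (t : ℕ → ℕ → ℝ)
    (lam : ℝ) (hT : TwoDimRec.HasMaxRoot (TwoDimRec.charPoly i₀ j₀ t) lam)
    (p : ℤ → ℤ → ℝ)
    (hrec : ∀ n k : ℤ, (n₀ : ℤ) ≤ n →
      p n k = ∑ i ∈ Finset.Icc 1 i₀, ∑ j ∈ Finset.Icc 0 j₀, t i j * p (n - (i : ℤ)) (k - (j : ℤ)))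
    (hp_zero : ∀ (n : ℕ) (k : ℤ), k < 0 → p n k = 0)
    (hp_fin : ∀ n < (n₀ : ℤ), (p n).support.Finite)
    (hp_growth : (fun n : ℕ => lam ^ n) =O[atTop] TwoDimRec.rowSum p)
    (hC : 0 < TwoDimRec.Csigma i₀ j₀ t lam)
    {Ω : ℕ → Type*} [∀ n, MeasurableSpace (Ω n)]
    (P : ∀ n, Measure (Ω n)) [∀ n, IsProbabilityMeasure (P n)]
    (X : ∀ n, Ω n → ℕ) (hX_meas : ∀ n, Measurable (X n))
    (hX : ∀ n : ℕ, TwoDimRec.rowSum p n ≠ 0 →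
      ∀ k : ℕ, (P n).real {ω | X n ω = k} = p n k / TwoDimRec.rowSum p n) :
    (∃ dμ γμ : ℝ, 0 < γμ ∧ γμ < 1 ∧
      (fun n : ℕ => (∫ ω, (X n ω : ℝ) ∂(P n)) -
        (TwoDimRec.Cmu i₀ j₀ t lam * (n : ℝ) + dμ)) =O[atTop] fun n : ℕ => γμ ^ n) ∧
    (∃ dσ γσ : ℝ, 0 < γσ ∧ γσ < 1 ∧
      (fun n : ℕ => variance (fun ω => (X n ω : ℝ)) (P n) -
        (TwoDimRec.Csigma i₀ j₀ t lam * (n : ℝ) + dσ)) =O[atTop] fun n : ℕ => γσ ^ n) ∧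
    TendstoInDistribution
      (fun (n : ℕ) (ω : Ω n) => ((X n ω : ℝ) - ∫ ω', (X n ω' : ℝ) ∂(P n)) /
        Real.sqrt (variance (fun ω' => (X n ω' : ℝ)) (P n)))
      atTop (id : ℝ → ℝ) P (gaussianReal 0 1) := by
  have hrows : TwoDimRec.IsRowRecurrence i₀ j₀ n₀ t p := hrec
  obtain ⟨L, hL, hLμ, hLσ⟩ := hT.exists_isRootExponent
  obtain ⟨g, γ, hγ0, hγ1, hQ⟩ := hrows.exists_quasiPowers (hrows.finite_support hp_fin) hp_zero
    hp_growth hT hL hX_meas hX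
  have hmean := hQ.isBigO_mean_sub
  have hvar := hQ.isBigO_variance_sub
  rw [hLμ] at hmean
  rw [hLσ] at hvar
  refine ⟨⟨_, γ, hγ0, hγ1, TwoDimRec.isBigO_sub_add_re hmean⟩,
    ⟨_, γ, hγ0, hγ1, TwoDimRec.isBigO_sub_add_re hvar⟩, ?_⟩
  exact hQ.tendstoInDistribution (fun n => (measurable_from_top.comp (hX_meas n)).aemeasurable)
    tendsto_natCast_atTop_atTop hLσ hC

theorem theorem2p6
    (i₀ j₀ n₀ : ℕ) (hi₀ : 0 < i₀) (hj₀ : 0 < j₀)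
    (t : ℕ → ℕ → ℝ)
    (ht : ∀ i ∈ Finset.Icc 1 i₀, 0 ≤ TwoDimRec.tHat j₀ t i)
    (lam : ℝ) (hT : TwoDimRec.HasMaxRoot (TwoDimRec.charPoly i₀ j₀ t) lam)
    (p : ℤ → ℤ → ℝ)
    (hrec : ∀ n k : ℤ, (n₀ : ℤ) ≤ n →
      p n k = ∑ i ∈ Finset.Icc 1 i₀, ∑ j ∈ Finset.Icc 0 j₀, t i j * p (n - (i : ℤ)) (k - (j : ℤ)))
    (hp_nonneg : ∀ n k : ℤ, 0 ≤ p n k)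
    (hp_zero : ∀ n k : ℤ, n < 0 ∨ k < 0 → p n k = 0)
    (hp_fin : {q : ℤ × ℤ | q.1 < (n₀ : ℤ) ∧ p q.1 q.2 ≠ 0}.Finite)
    (hp_theta : (fun n : ℕ => TwoDimRec.rowSum p n) =Θ[atTop] fun n : ℕ => lam ^ n)
    (hC : 0 < TwoDimRec.Csigma i₀ j₀ t lam)
    -- `X n` is any random variable whose mass function is `k ↦ p n k / ∑ i, p n i`;
    -- nothing is required for the finitely many `n` at which the row vanishes
    {Ω : ℕ → Type*} [∀ n, MeasurableSpace (Ω n)]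
    (P : ∀ n, Measure (Ω n)) [∀ n, IsProbabilityMeasure (P n)]
    (X : ∀ n, Ω n → ℕ) (hX_meas : ∀ n, Measurable (X n))
    (hX : ∀ n : ℕ, TwoDimRec.rowSum p n ≠ 0 →
      ∀ k : ℕ, (P n).real {ω | X n ω = k} = p n k / TwoDimRec.rowSum p n) :
    (∃ dμ γμ : ℝ, 0 < γμ ∧ γμ < 1 ∧
      (fun n : ℕ => (∫ ω, (X n ω : ℝ) ∂(P n)) -
        (TwoDimRec.Cmu i₀ j₀ t lam * (n : ℝ) + dμ)) =O[atTop] fun n : ℕ => γμ ^ n) ∧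
    (∃ dσ γσ : ℝ, 0 < γσ ∧ γσ < 1 ∧
      (fun n : ℕ => variance (fun ω => (X n ω : ℝ)) (P n) -
        (TwoDimRec.Csigma i₀ j₀ t lam * (n : ℝ) + dσ)) =O[atTop] fun n : ℕ => γσ ^ n) ∧
    TendstoInDistribution
      (fun (n : ℕ) (ω : Ω n) => ((X n ω : ℝ) - ∫ ω', (X n ω' : ℝ) ∂(P n)) /
        Real.sqrt (variance (fun ω' => (X n ω' : ℝ)) (P n)))
      atTop (id : ℝ → ℝ) P (gaussianReal 0 1) :=
  theorem2p6_general i₀ j₀ n₀ t lam hT p hrec (fun n k hk => hp_zero n k (.inr hk))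
    (fun n hn => (hp_fin.preimage (Prod.mk_right_injective n).injOn).subset fun _ hk => ⟨hn, hk⟩)
    hp_theta.2 hC P X hX_meas hX
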